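/- Let $H$ be a separable complex Hilbert space, $\alpha,\beta>0$, $0\le\varepsilon<\pi/2$, and let $\rho(t)=\alpha^2$ for $0<t<1$, $\rho(t)=\beta^2$ for $t>1$. Let $A$ be a normal (in general unbounded) operator in $H$ with compact inverse $A^{-1}$ whose spectrum lies in the sector $\{\lambda:|\arg\lambda|\le\varepsilon\}$, and let $A_0,A_1,A_2$ be linear operators such that the operators $B_j=A_jA^{-j}$ ($j=0,1,2$) are bounded on $H$. Put $\kappa(\varepsilon)=1$ for $\varepsilon<\pi/4$, $\kappa(\varepsilon)=\frac1{\sqrt2\cos\varepsilon}$ for $\pi/4\le\varepsilon<\pi/2$, $$c_0=\frac{\kappa(\varepsilon)}{\min(\alpha^2,\beta^2)},\qquad c_1=\frac1{2\cos\varepsilon\,\min(\alpha,\beta)},\qquad c_2=\frac{\max(\alpha,\beta)}{\min(\alpha,\beta)}\,\kappa(\varepsilon),$$ and assume $$c_0\|B_2\|+c_1\|B_1\|+c_2\|B_0\|<1 .$$ For an open interval $I$ let $W_2^1(I;H)$ be the space of functions $u$ with $u',Au\in L_2(I;H)$ and norm $(\|u'\|_{L_2}^2+\|Au\|_{L_2}^2)^{1/2}$,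 and let $W_2^2(I;H)$ be the space of functions $u$ with $u'',A^2u\in L_2(I;H)$ (derivatives in the sense of distributions). For $\gamma>0$ let $H_\gamma$ be the domain of $A^\gamma$ with the norm $\|x\|_\gamma=\|A^\gamma x\|$. Let $N(P)$ be the set of all $u\in W_2^2(\mathbb R_+;H)$ that satisfy $$-u''+\rho(t)A^2u+A_0u''+A_1u'+A_2u=0\quad\text{for almost all } t>0$$ and $u(0)=\varphi$ for some $\varphi\in H_{3/2}$, in the sense that $\lim_{t\to+0}\|u(t)-\varphi\|_{3/2}=0$. Then $N(P)$ is interior compact: for all $0<a<a_1<b_1<b<\infty$ and $M>0$, the set $$\{u\in N(P):\ \|u\|_{W_2^1((a,b);H)}\le M\}$$ is relatively compact in $W_2^1((a_1,b_1);H)$, that is, every sequence in it has a subsequence that converges in the norm of $W_2^1((a_1,b_1);H)$ to an element of $W_2^1((a_1,b_1);H)$. -/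

import Mathlib

open MeasureTheory Set Filter Topology
open scoped ContDiff

noncomputable section

namespace OperatorBVP

variable {H : Type*} [NormedAddCommGroup H] [InnerProductSpace ℂ H]

/-! Unbounded operators in a complex Hilbert space. -/

/-- The value `A x` for `x` in the domain of the unbounded operator `A`
(and `0` outside the domain; every use comes with a domain condition). -/
def app (A : H →ₗ.[ℂ] H) (x : H) : H :=
  open Classical in if h : x ∈ A.domain then A ⟨x, h⟩ else 0

/-- `x` belongs to the domain of `A ^ 2`. -/
def MemDomSq (A : H →ₗ.[ℂ] H) (x : H) : Prop :=
  x ∈ A.domain ∧ app A x ∈ A.domain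

/-- `A` is a normal operator: densely defined, closed, and `A* A = A A*`
(equality of unbounded operators, domains included, expressed through the graphs). -/
structure IsNormalOp [CompleteSpace H] (A : H →ₗ.[ℂ] H) : Prop where
  dense : Dense (A.domain : Set H)
  closed : A.IsClosed
  comm : ∀ x y : H,
    (∃ z, (x, z) ∈ A.graph ∧ (z, y) ∈ A.adjoint.graph) ↔
      (∃ z, (x, z) ∈ A.adjoint.graph ∧ (z, y) ∈ A.graph)

/-- The bounded everywhere defined operator `T` is the inverse of `A`. -/
def IsBoundedInverse (A : H →ₗ.[ℂ] H) (T : H →L[ℂ] H) : Prop :=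
  (∀ y : H, (T y, y) ∈ A.graph) ∧ ∀ x : A.domain, T (A x) = x

/-- The spectrum of the unbounded operator `A`: all `z` for which `A - z` has no bounded
everywhere defined inverse. -/
def opSpectrum (A : H →ₗ.[ℂ] H) : Set ℂ :=
  {z | ¬ ∃ R : H →L[ℂ] H,
    (∀ y : H, ∃ h : R y ∈ A.domain, A ⟨R y, h⟩ - z • R y = y) ∧
      ∀ x : A.domain, R (A x - z • (x : H)) = x}

/-- The sector `|arg z| ≤ ε`. -/
def sector (ε : ℝ) : Set ℂ := {z | |z.arg| ≤ ε}

/-- The operator `C A^{-j}` is defined on the whole space and equals the bounded operator `B`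
(here `T = A^{-1}`). -/
def IsBoundedCoeff (T : H →L[ℂ] H) (j : ℕ) (C : H →ₗ.[ℂ] H) (B : H →L[ℂ] H) : Prop :=
  ∀ x : H, ((T ^ j) x, B x) ∈ C.graph

/-! The scale `H_γ = D(A^γ)`, `‖x‖_γ = ‖A^γ x‖ = ‖|A|^γ x‖` for normal `A` with `T = A^{-1}`. -/

/-- `|A|^{-γ} = (T* T)^{γ/2}`, by the continuous functional calculus. -/
def absNegPow [CompleteSpace H] (T : H →L[ℂ] H) (γ : ℝ) : H →L[ℂ] H :=
  (ContinuousLinearMap.adjoint T * T) ^ (γ / 2)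

/-- `x ∈ H_γ`. -/
def MemScale [CompleteSpace H] (T : H →L[ℂ] H) (γ : ℝ) (x : H) : Prop :=
  ∃ y, absNegPow T γ y = x

/-- `‖x‖_γ`, the norm of `|A|^γ x`. -/
def scaleNorm [CompleteSpace H] (T : H →L[ℂ] H) (γ : ℝ) (x : H) : ℝ :=
  open Classical in if h : MemScale T γ x then ‖h.choose‖ else 0

/-! Sobolev spaces of vector functions on an open set of the line. -/

/-- `v` is the derivative of `u` on the open set `I` in the sense of distributions. -/
def HasWeakDeriv (I : Set ℝ) (u v : ℝ → H) : Prop :=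
  LocallyIntegrableOn u I volume ∧ LocallyIntegrableOn v I volume ∧
    ∀ ψ : ℝ → ℝ, ContDiff ℝ ∞ ψ → HasCompactSupport ψ → tsupport ψ ⊆ I →
      ∫ t in I, deriv ψ t • u t = - ∫ t in I, ψ t • v t

/-- The distributional derivative `du/dt` on `I` (unique almost everywhere when it exists). -/
def weakDeriv (I : Set ℝ) (u : ℝ → H) : ℝ → H :=
  open Classical in if h : ∃ v, HasWeakDeriv I u v then h.choose else 0

/-- `u ∈ W_2^1(I; H)`: both `u'` and `A u` are in `L_2(I; H)`. -/
structure MemW1 (A : H →ₗ.[ℂ] H) (I : Set ℝ) (u : ℝ → H) : Prop where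
  deriv : ∃ u' : ℝ → H, HasWeakDeriv I u u' ∧ MemLp u' 2 (volume.restrict I)
  mem_domain : ∀ᵐ t ∂(volume.restrict I), u t ∈ A.domain
  op : MemLp (fun t => app A (u t)) 2 (volume.restrict I)

/-- `‖u‖ = (‖u'‖² + ‖A u‖²)^{1/2}` in `W_2^1(I; H)`. -/
def W1norm (A : H →ₗ.[ℂ] H) (I : Set ℝ) (u : ℝ → H) : ℝ :=
  Real.sqrt ((∫ t in I, ‖weakDeriv I u t‖ ^ 2) + ∫ t in I, ‖app A (u t)‖ ^ 2)

/-- `u ∈ W_2^2(I; H)`: both `u''` and `A² u` are in `L_2(I; H)`. -/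
structure MemW2 (A : H →ₗ.[ℂ] H) (I : Set ℝ) (u : ℝ → H) : Prop where
  deriv : ∃ u' u'' : ℝ → H, HasWeakDeriv I u u' ∧ HasWeakDeriv I u' u'' ∧
    MemLp u'' 2 (volume.restrict I)
  mem_domain : ∀ᵐ t ∂(volume.restrict I), MemDomSq A (u t)
  op : MemLp (fun t => app A (app A (u t))) 2 (volume.restrict I)

/-- `K` is relatively compact in `W_2^1(I; H)`: it consists of elements of that space, and every
sequence in `K` has a subsequence that converges in its norm to an element of the space. -/
def RelCompactW1 (A : H →ₗ.[ℂ] H) (I : Set ℝ) (K : Set (ℝ → H)) : Prop :=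
  (∀ u ∈ K, MemW1 A I u) ∧
    ∀ u : ℕ → ℝ → H, (∀ n, u n ∈ K) →
      ∃ v : ℝ → H, MemW1 A I v ∧ ∃ s : ℕ → ℕ, StrictMono s ∧
        Tendsto (fun n => W1norm A I (u (s n) - v)) atTop (𝓝 0)

/-! The boundary value problem. -/

/-- The coefficient `ρ`, equal to `α²` on `(0, 1)` and to `β²` on `(1, ∞)`. -/
def rho (α β : ℝ) (t : ℝ) : ℝ := if t < 1 then α ^ 2 else β ^ 2

/-- `u` satisfies `-u'' + ρ A² u + A₀ u'' + A₁ u' + A₂ u = 0` almost everywhere on `(0, ∞)`. -/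
def SolvesEq (A A₀ A₁ A₂ : H →ₗ.[ℂ] H) (α β : ℝ) (u : ℝ → H) : Prop :=
  let u' := weakDeriv (Ioi 0) u
  let u'' := weakDeriv (Ioi 0) u'
  ∀ᵐ t ∂(volume.restrict (Ioi (0 : ℝ))),
    MemDomSq A (u t) ∧ u'' t ∈ A₀.domain ∧ u' t ∈ A₁.domain ∧ u t ∈ A₂.domain ∧
      -u'' t + rho α β t • app A (app A (u t)) + app A₀ (u'' t) + app A₁ (u' t)
        + app A₂ (u t) = 0

/-- `u(0) = φ` in the sense that `‖u(t) - φ‖_{3/2} → 0` as `t → +0` (here `T = A^{-1}`). -/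
def HasInitialValue [CompleteSpace H] (T : H →L[ℂ] H) (φ : H) (u : ℝ → H) : Prop :=
  (∀ᶠ t in 𝓝[>] (0 : ℝ), MemScale T (3 / 2) (u t - φ)) ∧
    Tendsto (fun t => scaleNorm T (3 / 2) (u t - φ)) (𝓝[>] 0) (𝓝 0)

/-- The space `N(P)`: all `u ∈ W_2^2(ℝ₊; H)` that solve the homogeneous equation and attain some
initial value `φ ∈ H_{3/2}`. -/
def solutionSpace [CompleteSpace H] (A : H →ₗ.[ℂ] H) (T : H →L[ℂ] H) (A₀ A₁ A₂ : H →ₗ.[ℂ] H)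
    (α β : ℝ) : Set (ℝ → H) :=
  {u | MemW2 A (Ioi 0) u ∧ SolvesEq A A₀ A₁ A₂ α β u ∧
    ∃ φ : H, MemScale T (3 / 2) φ ∧ HasInitialValue T φ u}

/-- `N` is interior compact: for all `0 < a < a₁ < b₁ < b` and `M > 0`, the elements of `N` whose
norm in `W_2^1((a, b); H)` is at most `M` form a relatively compact set in
`W_2^1((a₁, b₁); H)`. -/
def InteriorCompact (A : H →ₗ.[ℂ] H) (N : Set (ℝ → H)) : Prop :=
  ∀ a a₁ b₁ b M : ℝ, 0 < a → a < a₁ → a₁ < b₁ → b₁ < b → 0 < M →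
    RelCompactW1 A (Ioo a₁ b₁) {u | u ∈ N ∧ MemW1 A (Ioo a b) u ∧ W1norm A (Ioo a b) u ≤ M}

/-! The constants. -/

/-- `1` for `ε < π/4`, and `1 / (√2 cos ε)` for `π/4 ≤ ε < π/2`. -/
def sectorConst (ε : ℝ) : ℝ :=
  if ε < Real.pi / 4 then 1 else 1 / (Real.sqrt 2 * Real.cos ε)

/-- The constant `c₀(ε; α; β)`. -/
def c₀ (ε α β : ℝ) : ℝ := 1 / min (α ^ 2) (β ^ 2) * sectorConst ε

/-- The constant `c₁(ε; α; β)`. -/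
def c₁ (ε α β : ℝ) : ℝ := 1 / (2 * Real.cos ε * min α β)

/-- The constant `c₂(ε; α; β)`. -/
def c₂ (ε α β : ℝ) : ℝ := max α β / min α β * sectorConst ε

end OperatorBVP

end

/-!
For a solution `u` and a smooth cutoff `χ` supported in `(a, b)`, the function `χ u` extends by
zero to the whole line, and its equation there has the right-hand side `f` made of the commutator
terms `χ' u'`, `χ'' u`, `χ' A u`, whose `L²` norms are controlled by the `W_2^1` norm of `u` on
`(a, b)`.

On the line the estimates of `‖A² w‖`, `‖A w'‖` and `‖w''‖` through `g = -w'' + ρ A² w` hold with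
the constants `c₀`, `c₁`, `c₂` (`exists_energy_estimates`). The reason is the identity `‖ρ^{-1/2}
g‖² = ‖ρ^{-1/2} w''‖² + ‖ρ^{1/2} A² w‖² - 2 Re ⟨w'', A² w⟩`, in whose cross term the discontinuous
coefficient cancels. With `T = A⁻¹` and `v = A² w`, Plancherel's theorem turns `-Re ⟨w'', A² w⟩`
into `∫ (2πξ)² Re ⟨T² v̂, v̂⟩ dξ`, which is at least `cos 2ε ‖A w'‖²` because the spectrum of `T`
lies in the sector; a contraction `U` with `U T = T*` gives `‖A w'‖² ≤ ‖ρ^{-1/2} w''‖ ‖ρ^{1/2} A²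
w‖`.

The perturbation is `B₀ w'' + B₁ A w' + B₂ A² w` up to commutator terms, so the smallness
condition absorbs it, and `A² (χ u)`, `A (χ u)'`, `(χ u)''` are bounded in `L²` by a constant that
depends on `u` through its `W_2^1` norm only (`mem_boundedPrimitives_of_solution`).

Therefore `(χ u)'` and `A (χ u)` are of the form `T h` with `h` bounded in `L²`, have bounded
derivatives and supports in `[a, b]`. As `T` is compact, such functions form a totally bounded
subset of `L²(ℝ; H)` (`totallyBounded_boundedPrimitives`), and limits of `u'` and `A u` in `L²`
are limits in `W_2^1` (`relCompactW1_of_totallyBounded`).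
-/

namespace OperatorBVP

open scoped FourierTransform SchwartzMap

/-! ### The bounded inverse of a normal operator -/

section

variable {H : Type*} [NormedAddCommGroup H] [InnerProductSpace ℂ H]

lemma IsBoundedInverse.mem_domain {A : H →ₗ.[ℂ] H} {T : H →L[ℂ] H} (h : IsBoundedInverse A T)
    (y : H) : T y ∈ A.domain :=
  LinearPMap.mem_domain_of_mem_graph (h.1 y)

lemma IsBoundedInverse.app_apply {A : H →ₗ.[ℂ] H} {T : H →L[ℂ] H} (h : IsBoundedInverse A T)
    (y : H) : app A (T y) = y := by
  rw [app, dif_pos (h.mem_domain y)]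
  exact ((LinearPMap.mem_graph_iff' _).1 (h.1 y)).elim fun z hz => by
    obtain ⟨hz1, hz2⟩ := Prod.mk.inj hz
    refine Eq.trans ?_ hz2
    congr 1; exact Subtype.ext hz1.symm

lemma IsBoundedInverse.apply_app {A : H →ₗ.[ℂ] H} {T : H →L[ℂ] H} (h : IsBoundedInverse A T)
    {x : H} (hx : x ∈ A.domain) : T (app A x) = x := by
  rw [app, dif_pos hx]; exact h.2 ⟨x, hx⟩

lemma IsBoundedInverse.injective {A : H →ₗ.[ℂ] H} {T : H →L[ℂ] H} (h : IsBoundedInverse A T) :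
    Function.Injective T :=
  Function.LeftInverse.injective (g := app A) h.app_apply

lemma IsBoundedInverse.denseRange {A : H →ₗ.[ℂ] H} {T : H →L[ℂ] H} (h : IsBoundedInverse A T)
    (hd : Dense (A.domain : Set H)) : DenseRange T :=
  hd.mono fun x hx => ⟨app A x, h.apply_app hx⟩

lemma IsBoundedCoeff.app_apply {T : H →L[ℂ] H} {j : ℕ} {C : H →ₗ.[ℂ] H} {B : H →L[ℂ] H}
    (h : IsBoundedCoeff T j C B) (x : H) : app C ((T ^ j) x) = B x := by
  obtain ⟨z, hz⟩ := (LinearPMap.mem_graph_iff' _).1 (h x)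
  obtain ⟨hz1, hz2⟩ := Prod.mk.inj hz
  have hm : (T ^ j) x ∈ C.domain := hz1 ▸ z.2
  rw [app, dif_pos hm, ← hz2]; congr 1; exact Subtype.ext hz1.symm

/-- The sector is invariant under inversion, so it also contains the spectrum of `A⁻¹`. -/
lemma IsBoundedInverse.spectrum_subset {A : H →ₗ.[ℂ] H} {T : H →L[ℂ] H} {ε : ℝ}
    (h : IsBoundedInverse A T) (hε₀ : 0 ≤ ε) (hε : ε < Real.pi / 2)
    (hspec : opSpectrum A ⊆ sector ε) :
    spectrum ℂ T ⊆ sector ε := by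
  intro μ hμ
  by_cases h0 : μ = 0
  · simpa [h0, sector] using hε₀
  suffices hz : μ⁻¹ ∈ opSpectrum A by
    have := hspec hz
    simp only [sector, mem_ofPred_eq] at this ⊢
    by_cases hpi : μ.arg = Real.pi
    · rw [Complex.arg_inv, if_pos hpi, abs_of_pos Real.pi_pos] at this
      linarith [Real.pi_pos]
    · rwa [Complex.arg_inv, if_neg hpi, abs_neg] at this
  rintro ⟨R, hR1, hR2⟩
  refine hμ ?_
  -- If `R` inverts `A - μ⁻¹`, then `1 + μ⁻¹ R` inverts `1 - μ⁻¹ T`.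
  have e1 : ∀ y, R y - μ⁻¹ • T (R y) = T y := by
    intro y
    obtain ⟨hd, hy⟩ := hR1 y
    have := congrArg T hy
    rw [map_sub, map_smul] at this
    rw [← this]; congr 1; exact (h.2 ⟨R y, hd⟩).symm
  have e2 : ∀ y, R y - μ⁻¹ • R (T y) = T y := by
    intro y
    have := hR2 ⟨T y, h.mem_domain y⟩
    rw [map_sub, map_smul] at this
    convert this using 2
    have h2 := h.app_apply y
    rw [app, dif_pos (h.mem_domain y)] at h2
    rw [h2]
  have hu : IsUnit ((1 : H →L[ℂ] H) - μ⁻¹ • T) := by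
    refine isUnit_iff_exists.2 ⟨1 + μ⁻¹ • R, ?_, ?_⟩ <;> refine ContinuousLinearMap.ext fun y => ?_
    · have := e1 y
      simp only [mul_apply_eq_comp, _root_.sub_apply,
        _root_.add_apply, one_apply_eq_self,
        _root_.smul_apply, map_add, map_smul]
      rw [← this]
      module
    · have := sub_eq_iff_eq_add.1 (e2 y)
      simp only [mul_apply_eq_comp, _root_.sub_apply,
        _root_.add_apply, one_apply_eq_self,
        _root_.smul_apply, map_sub, map_smul]
      rw [this]
      module
  have := (IsUnit.mk0 μ h0).map (algebraMap ℂ (H →L[ℂ] H)) |>.mul hu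
  change IsUnit (algebraMap ℂ (H →L[ℂ] H) μ - T)
  convert this using 1
  rw [mul_sub, mul_one, Algebra.algebraMap_eq_smul_one, smul_mul_assoc, one_mul, smul_smul,
    mul_inv_cancel₀ h0, one_smul]

variable [CompleteSpace H]

lemma IsBoundedInverse.isStarNormal {A : H →ₗ.[ℂ] H} {T : H →L[ℂ] H} (h : IsBoundedInverse A T)
    (hA : IsNormalOp A) : IsStarNormal T := by
  -- The adjoint of `T` is the bounded inverse of the adjoint of `A`.
  have hmem : ∀ x y : H, (x, y) ∈ A.adjoint.graph ↔ ContinuousLinearMap.adjoint T y = x := by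
    intro x y
    rw [LinearPMap.adjoint_graph_eq_graph_adjoint hA.dense, Submodule.mem_adjoint_iff]
    constructor
    · intro hxy
      refine ext_inner_left ℂ fun z => ?_
      rw [ContinuousLinearMap.adjoint_inner_right]
      exact (sub_eq_zero.1 (hxy _ _ (h.1 z))).symm
    · rintro rfl a b hab
      obtain ⟨z, hz⟩ := (LinearPMap.mem_graph_iff' _).1 hab
      obtain ⟨rfl, rfl⟩ := Prod.mk.inj hz
      rw [ContinuousLinearMap.adjoint_inner_right, h.2 z, sub_self]
  refine ⟨?_⟩
  rw [commute_iff_eq]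
  refine ContinuousLinearMap.ext fun y => ?_
  obtain ⟨z, hz1, hz2⟩ := (hA.comm (T (ContinuousLinearMap.adjoint T y)) y).1
    ⟨ContinuousLinearMap.adjoint T y, h.1 _, (hmem _ _).2 rfl⟩
  have hz : z = T y := by
    obtain ⟨w, hw⟩ := (LinearPMap.mem_graph_iff' _).1 hz2
    obtain ⟨rfl, rfl⟩ := Prod.mk.inj hw
    exact (h.2 w).symm
  rw [hmem, hz] at hz1
  exact hz1

/-- The polar-type operator `U = T* T⁻¹`, a contraction since `‖T* x‖ = ‖T x‖` for normal `T`. It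
turns `⟨T* T x, x⟩` into `⟨U T² x, x⟩`. -/
lemma exists_contraction_comp_eq_adjoint (T : H →L[ℂ] H) [hT : IsStarNormal T]
    (hd : DenseRange T) :
    ∃ U : H →L[ℂ] H, (∀ x, U (T x) = ContinuousLinearMap.adjoint T x) ∧ ‖U‖ ≤ 1 := by
  have hn : ∀ x, ‖(ContinuousLinearMap.adjoint T : H →ₗ[ℂ] H) x‖ ≤ 1 * ‖(T : H →ₗ[ℂ] H) x‖ := by
    intro x
    rw [one_mul]
    exact ((ContinuousLinearMap.isStarNormal_iff_norm_eq_adjoint.1 hT x)).ge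
  exact ⟨(ContinuousLinearMap.adjoint T : H →ₗ[ℂ] H).extendOfNorm (T : H →ₗ[ℂ] H),
    fun x => LinearMap.extendOfNorm_eq hd ⟨1, hn⟩ x,
    LinearMap.opNorm_extendOfNorm_le hd zero_le_one hn⟩

lemma cos_two_mul_norm_sq_le_re_sq {ε : ℝ} (hε : ε < Real.pi / 2) {z : ℂ} (hz : z ∈ sector ε) :
    Real.cos (2 * ε) * ‖z‖ ^ 2 ≤ (z ^ 2).re := by
  have h1 : (z ^ 2).re = Real.cos (2 * |z.arg|) * ‖z‖ ^ 2 := by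
    have h2 : Real.cos (2 * |z.arg|) = Real.cos (2 * z.arg) := by
      rw [← Real.cos_abs (2 * z.arg), abs_mul, abs_two]
    rw [h2, Real.cos_two_mul]
    have hc := Complex.norm_mul_cos_arg z
    have hn := Complex.sq_norm z
    rw [Complex.normSq_apply] at hn
    rw [sq z, Complex.mul_re]
    have : (‖z‖ * Real.cos z.arg) ^ 2 = z.re ^ 2 := by rw [hc]
    nlinarith
  rw [h1]
  refine mul_le_mul_of_nonneg_right ?_ (sq_nonneg _)
  exact Real.cos_le_cos_of_nonneg_of_le_pi (by positivity) (by linarith)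
    (mul_le_mul_of_nonneg_left hz zero_le_two)

open scoped ComplexOrder in
/-- The sector condition in the form used for the energy identity, by positivity of the function
`2 Re z² - 2 cos 2ε |z|²` on the spectrum and the continuous functional calculus. -/
lemma cos_mul_norm_sq_le_re_inner (T : H →L[ℂ] H) [hT : IsStarNormal T] {ε : ℝ}
    (hε : ε < Real.pi / 2) (hspec : spectrum ℂ T ⊆ sector ε) (x : H) :
    Real.cos (2 * ε) * ‖T x‖ ^ 2 ≤ (inner ℂ (T (T x)) x).re := by
  have key : 0 ≤ cfc (fun z : ℂ => z * z + star (z * z)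
      - (2 * Real.cos (2 * ε) : ℝ) * (star z * z)) T := by
    refine cfc_nonneg fun z hz => ?_
    have h1 := cos_two_mul_norm_sq_le_re_sq hε (hspec hz)
    have h2 : z * z + star (z * z) - (2 * Real.cos (2 * ε) : ℝ) * (star z * z)
        = ((2 * ((z ^ 2).re - Real.cos (2 * ε) * ‖z‖ ^ 2) : ℝ) : ℂ) := by
      have h3 : star z * z = ((‖z‖ ^ 2 : ℝ) : ℂ) := by
        rw [Complex.star_def, Complex.conj_mul']; push_cast; ring
      rw [h3, Complex.star_def, Complex.add_conj, ← sq]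
      push_cast; ring
    rw [h2]
    exact Complex.zero_le_real.2 (by linarith)
  have e : cfc (fun z : ℂ => z * z + star (z * z)
      - (2 * Real.cos (2 * ε) : ℝ) * (star z * z)) T
      = T * T + star (T * T) - ((2 * Real.cos (2 * ε) : ℝ) : ℂ) • (star T * T) := by
    rw [cfc_sub (fun z : ℂ => z * z + star (z * z)) _ T (by fun_prop) (by fun_prop),
      cfc_add T (fun z : ℂ => z * z) _ (by fun_prop) (by fun_prop),
      cfc_star (fun z : ℂ => z * z) T,
      cfc_const_mul _ (fun z : ℂ => star z * z) T (by fun_prop),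
      cfc_mul (fun z : ℂ => z) (fun z : ℂ => z) T (by fun_prop) (by fun_prop),
      cfc_mul (fun z : ℂ => star z) (fun z : ℂ => z) T (by fun_prop) (by fun_prop),
      cfc_star (fun z : ℂ => z) T, cfc_id' ℂ T]
  rw [e, ContinuousLinearMap.nonneg_iff_isPositive] at key
  have h1 := key.re_inner_nonneg_left x
  rw [star_mul, ContinuousLinearMap.star_eq_adjoint] at h1
  simp only [_root_.sub_apply, _root_.add_apply,
    _root_.smul_apply, mul_apply_eq_comp, inner_sub_left,
    inner_add_left, ContinuousLinearMap.adjoint_inner_left, map_sub, map_add] at h1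
  have h2 : RCLike.re (inner ℂ x (T (T x))) = RCLike.re (inner ℂ (T (T x)) x) :=
    inner_re_symm ..
  rw [h2, inner_smul_left, ContinuousLinearMap.adjoint_inner_left, Complex.conj_ofReal,
    inner_self_eq_norm_sq_to_K] at h1
  have h3 : RCLike.re (((2 * Real.cos (2 * ε) : ℝ) : ℂ) * ((‖T x‖ : ℝ) : ℂ) ^ 2)
      = 2 * Real.cos (2 * ε) * ‖T x‖ ^ 2 := by
    rw [← Complex.ofReal_pow, ← Complex.ofReal_mul]; exact Complex.ofReal_re _
  erw [h3] at h1
  change 0 ≤ (inner ℂ (T (T x)) x).re + (inner ℂ (T (T x)) x).re - _ at h1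
  linarith

end

/-! ### Weak derivatives -/

section

variable {H : Type*} [NormedAddCommGroup H] [InnerProductSpace ℂ H]

lemma integrable_smul_of_tsupport_subset {𝕜 E : Type*} [RCLike 𝕜] [NormedAddCommGroup E]
    [NormedSpace 𝕜 E] {I : Set ℝ} {u : ℝ → E} {χ : ℝ → 𝕜}
    (hu : LocallyIntegrableOn u I) (hχ : Continuous χ)
    (hc : HasCompactSupport χ) (hI : tsupport χ ⊆ I) : Integrable fun t => χ t • u t := by
  have h1 : IntegrableOn (fun t => χ t • u t) (tsupport χ) :=
    (hu.integrableOn_compact_subset hI hc).continuousOn_smul hχ.continuousOn hc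
  rwa [integrableOn_iff_integrable_of_support_subset] at h1
  intro t ht
  by_contra h
  exact ht (by simp [image_eq_zero_of_notMem_tsupport h])

lemma setIntegral_smul_eq_integral {𝕜 : Type*} [RCLike 𝕜] [NormedSpace 𝕜 H] {I : Set ℝ}
    {χ : ℝ → 𝕜} (hI : tsupport χ ⊆ I) (u : ℝ → H) :
    ∫ t in I, χ t • u t = ∫ t, χ t • u t := by
  refine setIntegral_eq_integral_of_forall_compl_eq_zero fun t ht => ?_
  rw [image_eq_zero_of_notMem_tsupport fun h => ht (hI h), zero_smul]

lemma HasWeakDeriv.integral_deriv_smul {I : Set ℝ} {u v : ℝ → H} (h : HasWeakDeriv I u v)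
    {ψ : ℝ → ℝ} (hψ : ContDiff ℝ ∞ ψ) (hc : HasCompactSupport ψ) (hI : tsupport ψ ⊆ I) :
    ∫ t, deriv ψ t • u t = - ∫ t, ψ t • v t := by
  have := h.2.2 ψ hψ hc hI
  rwa [setIntegral_smul_eq_integral (tsupport_deriv_subset.trans hI),
    setIntegral_smul_eq_integral hI] at this

/-- The defining identity of the weak derivative holds for complex test functions. -/
lemma HasWeakDeriv.integral_deriv_smul_complex {I : Set ℝ} {u v : ℝ → H}
    (h : HasWeakDeriv I u v) {ψ : ℝ → ℂ} (hψ : ContDiff ℝ ∞ ψ) (hc : HasCompactSupport ψ)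
    (hI : tsupport ψ ⊆ I) :
    ∫ t, deriv ψ t • u t = - ∫ t, ψ t • v t := by
  have hre : ContDiff ℝ ∞ fun t => (ψ t).re := Complex.reCLM.contDiff.comp hψ
  have him : ContDiff ℝ ∞ fun t => (ψ t).im := Complex.imCLM.contDiff.comp hψ
  have cre : HasCompactSupport fun t => (ψ t).re := hc.comp_left (g := Complex.re) rfl
  have cim : HasCompactSupport fun t => (ψ t).im := hc.comp_left (g := Complex.im) rfl
  have sre : tsupport (fun t => (ψ t).re) ⊆ I :=
    (closure_mono (Function.support_comp_subset (g := Complex.re) rfl ψ)).trans hI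
  have sim : tsupport (fun t => (ψ t).im) ⊆ I :=
    (closure_mono (Function.support_comp_subset (g := Complex.im) rfl ψ)).trans hI
  have key : ∀ (a b : ℝ → ℝ) (f : ℝ → H), (Integrable fun t => a t • f t) →
      (Integrable fun t => b t • f t) →
      ∫ t, ((a t : ℂ) + b t * Complex.I) • f t
        = (∫ t, a t • f t) + Complex.I • ∫ t, b t • f t := by
    intro a b f ha hb
    have hb' : Integrable fun t => Complex.I • b t • f t := hb.smul Complex.I
    rw [← integral_smul, ← integral_add ha hb']
    refine integral_congr_ae (Eventually.of_forall fun t => ?_)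
    simp only [add_smul, mul_comm _ Complex.I, mul_smul, Complex.coe_smul]
  have hd : ∀ t, deriv ψ t = ((deriv (fun t => (ψ t).re) t : ℝ) : ℂ)
      + ((deriv (fun t => (ψ t).im) t : ℝ) : ℂ) * Complex.I := by
    intro t
    have h1 := (hψ.differentiable (by simp) t).hasDerivAt
    have h2 : deriv (fun t => (ψ t).re) t = (deriv ψ t).re :=
      (Complex.reCLM.hasFDerivAt.comp_hasDerivAt t h1).deriv
    have h3 : deriv (fun t => (ψ t).im) t = (deriv ψ t).im :=
      (Complex.imCLM.hasFDerivAt.comp_hasDerivAt t h1).deriv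
    rw [h2, h3, Complex.re_add_im]
  have e1 := key _ _ u
    (integrable_smul_of_tsupport_subset h.1 (hre.continuous_deriv (by simp)) cre.deriv
      (tsupport_deriv_subset.trans sre))
    (integrable_smul_of_tsupport_subset h.1 (him.continuous_deriv (by simp)) cim.deriv
      (tsupport_deriv_subset.trans sim))
  have e2 := key _ _ v
    (integrable_smul_of_tsupport_subset h.2.1 hre.continuous cre sre)
    (integrable_smul_of_tsupport_subset h.2.1 him.continuous cim sim)
  simp only [← hd] at e1
  simp only [Complex.re_add_im] at e2
  rw [e1, e2, h.integral_deriv_smul hre cre sre, h.integral_deriv_smul him cim sim, smul_neg,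
    neg_add]

/-- The Fourier transform of the derivative `χ' u + χ u'` of a localized function `χ u`. -/
lemma HasWeakDeriv.fourier_cutoff {I : Set ℝ} {u v : ℝ → H} (h : HasWeakDeriv I u v)
    {χ : ℝ → ℝ} (hχ : ContDiff ℝ ∞ χ) (hc : HasCompactSupport χ) (hI : tsupport χ ⊆ I) (ξ : ℝ) :
    𝓕 (fun t => deriv χ t • u t + χ t • v t) ξ
      = (2 * Real.pi * Complex.I * ξ) • 𝓕 (fun t => χ t • u t) ξ := by
  set e : ℝ → ℂ := fun t => Complex.exp (-(2 * Real.pi * Complex.I * ξ) * t) with he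
  have hechar : ∀ (f : ℝ → H), 𝓕 f ξ = ∫ t, e t • f t := by
    intro f
    rw [Real.fourier_real_eq_integral_exp_smul]
    refine integral_congr_ae (Eventually.of_forall fun t => ?_)
    simp only [he]
    congr 2; push_cast; ring
  have hes : ContDiff ℝ ∞ e := by
    refine Complex.contDiff_exp.comp ?_ |>.of_le le_rfl
    exact contDiff_const.mul Complex.ofRealCLM.contDiff
  have hed : ∀ t, HasDerivAt e (-(2 * Real.pi * Complex.I * ξ) * e t) t := by
    intro t
    have h1 : HasDerivAt (fun s : ℝ => (s : ℂ)) 1 t := Complex.ofRealCLM.hasDerivAt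
    convert (h1.const_mul (-(2 * Real.pi * Complex.I * ξ))).cexp using 1
    simp only [he]; ring
  have hχd : ∀ t, HasDerivAt (fun t => (χ t : ℂ)) ((deriv χ t : ℝ) : ℂ) t := fun t =>
    (hχ.differentiable (by simp) t).hasDerivAt.ofReal_comp
  have hχC : ContDiff ℝ ∞ fun t => (χ t : ℂ) := Complex.ofRealCLM.contDiff.comp hχ
  have hcC : HasCompactSupport fun t => (χ t : ℂ) := hc.comp_left (g := Complex.ofReal) rfl
  have hsC : tsupport (fun t => (χ t : ℂ)) ⊆ I :=
    (closure_mono (Function.support_comp_subset (g := Complex.ofReal) rfl χ)).trans hI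
  have hsψ : tsupport (fun t => e t * (χ t : ℂ)) ⊆ tsupport (fun t => (χ t : ℂ)) :=
    tsupport_mul_subset_right
  have hcψ : HasCompactSupport (fun t => e t * (χ t : ℂ)) := hcC.mul_left
  have hψ : ContDiff ℝ ∞ (fun t => e t * (χ t : ℂ)) := hes.mul hχC
  have key := h.integral_deriv_smul_complex hψ hcψ (hsψ.trans hsC)
  have i1 : Integrable fun t => e t • (deriv χ t • u t) := by
    have := integrable_smul_of_tsupport_subset (𝕜 := ℂ)
      (χ := fun t => e t * ((deriv χ t : ℝ) : ℂ)) h.1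
      (hes.continuous.mul (Complex.continuous_ofReal.comp (hχ.continuous_deriv (by simp))))
      ((hc.deriv.comp_left (g := Complex.ofReal) rfl).mul_left)
      (tsupport_mul_subset_right.trans ((closure_mono
        (Function.support_comp_subset (g := Complex.ofReal) rfl _)).trans
          (tsupport_deriv_subset.trans hI)))
    simpa only [mul_smul, Complex.coe_smul] using this
  have i2 : Integrable fun t => e t • (χ t • u t) := by
    have := integrable_smul_of_tsupport_subset h.1 hψ.continuous hcψ (hsψ.trans hsC)
    simpa only [mul_smul, Complex.coe_smul] using this
  have i3 : Integrable fun t => e t • (χ t • v t) := by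
    have := integrable_smul_of_tsupport_subset h.2.1 hψ.continuous hcψ (hsψ.trans hsC)
    simpa only [mul_smul, Complex.coe_smul] using this
  rw [hechar, hechar]
  simp only [smul_add]
  rw [integral_add i1 i3]
  have hd : ∀ t, deriv (fun t => e t * (χ t : ℂ)) t • u t
      = -(2 * Real.pi * Complex.I * ξ) • (e t • (χ t • u t)) + e t • (deriv χ t • u t) := by
    intro t
    rw [show deriv (fun t => e t * (χ t : ℂ)) t = _ from ((hed t).mul (hχd t)).deriv]
    simp only [← Complex.coe_smul, ← mul_smul, ← add_smul, mul_assoc]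
  simp only [hd] at key
  have i4 : Integrable fun t => -(2 * Real.pi * Complex.I * ξ) • (e t • (χ t • u t)) :=
    i2.smul (-(2 * Real.pi * Complex.I * ξ))
  rw [integral_add i4 i1, integral_smul] at key
  simp only [mul_smul, Complex.coe_smul] at key
  have hk := eq_sub_of_add_eq' key
  rw [hk]; simp only [mul_smul, Complex.coe_smul]
  module

lemma HasWeakDeriv.congr_ae {I : Set ℝ} {u v u' v' : ℝ → H} (h : HasWeakDeriv I u v)
    (hu : u =ᵐ[volume.restrict I] u') (hv : v =ᵐ[volume.restrict I] v') :
    HasWeakDeriv I u' v' := by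
  have hloc : ∀ {f g : ℝ → H}, LocallyIntegrableOn f I → f =ᵐ[volume.restrict I] g →
      LocallyIntegrableOn g I := by
    intro f g hf hfg x hx
    obtain ⟨s, hs, hi⟩ := hf x hx
    refine ⟨s ∩ I, inter_mem hs self_mem_nhdsWithin, ?_⟩
    exact (hi.mono_set inter_subset_left).congr_fun_ae
      (ae_restrict_of_ae_restrict_of_subset inter_subset_right hfg)
  refine ⟨hloc h.1 hu, hloc h.2.1 hv, fun ψ h1 h2 h3 => ?_⟩
  rw [← integral_congr_ae (hu.mono fun t ht => congrArg (deriv ψ t • ·) ht),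
    ← integral_congr_ae (hv.mono fun t ht => congrArg (ψ t • ·) ht)]
  exact h.2.2 ψ h1 h2 h3

lemma HasWeakDeriv.mono {I J : Set ℝ} {u v : ℝ → H} (h : HasWeakDeriv I u v) (hJ : J ⊆ I) :
    HasWeakDeriv J u v := by
  refine ⟨h.1.mono_set hJ, h.2.1.mono_set hJ, fun ψ h1 h2 h3 => ?_⟩
  rw [setIntegral_smul_eq_integral (tsupport_deriv_subset.trans h3),
    setIntegral_smul_eq_integral h3]
  exact h.integral_deriv_smul h1 h2 (h3.trans hJ)

lemma HasWeakDeriv.sub {I : Set ℝ} {u v u' v' : ℝ → H} (h : HasWeakDeriv I u v)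
    (h' : HasWeakDeriv I u' v') : HasWeakDeriv I (u - u') (v - v') := by
  refine ⟨h.1.sub h'.1, h.2.1.sub h'.2.1, fun ψ h1 h2 h3 => ?_⟩
  have s3 := (tsupport_deriv_subset (f := ψ)).trans h3
  have c3 := h1.continuous_deriv (by simp)
  rw [setIntegral_smul_eq_integral s3, setIntegral_smul_eq_integral h3]
  simp only [Pi.sub_apply, smul_sub]
  rw [integral_sub (integrable_smul_of_tsupport_subset h.1 c3 h2.deriv s3)
    (integrable_smul_of_tsupport_subset h'.1 c3 h2.deriv s3),
    integral_sub (integrable_smul_of_tsupport_subset h.2.1 h1.continuous h2 h3)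
    (integrable_smul_of_tsupport_subset h'.2.1 h1.continuous h2 h3),
    h.integral_deriv_smul h1 h2 h3, h'.integral_deriv_smul h1 h2 h3]
  abel

lemma HasWeakDeriv.hasWeakDeriv_weakDeriv {I : Set ℝ} {u v : ℝ → H} (h : HasWeakDeriv I u v) :
    HasWeakDeriv I u (weakDeriv I u) := by
  have hex : ∃ v, HasWeakDeriv I u v := ⟨v, h⟩
  rw [weakDeriv, dif_pos hex]
  exact hex.choose_spec

variable [CompleteSpace H]

/-- Weak derivatives on an open set are unique almost everywhere. -/
lemma HasWeakDeriv.ae_eq {I : Set ℝ} (hI : IsOpen I) {u v v' : ℝ → H} (h : HasWeakDeriv I u v)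
    (h' : HasWeakDeriv I u v') : v =ᵐ[volume.restrict I] v' := by
  have := hI.ae_eq_zero_of_integral_contDiff_smul_eq_zero (h.2.1.sub h'.2.1) ?_
  · rw [EventuallyEq, ae_restrict_iff' hI.measurableSet]
    filter_upwards [this] with t ht hti
    exact sub_eq_zero.1 (ht hti)
  · intro ψ h1 h2 h3
    simp only [Pi.sub_apply, smul_sub]
    rw [integral_sub (integrable_smul_of_tsupport_subset h.2.1 h1.continuous h2 h3)
      (integrable_smul_of_tsupport_subset h'.2.1 h1.continuous h2 h3), sub_eq_zero]
    exact neg_injective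
      ((h.integral_deriv_smul h1 h2 h3).symm.trans (h'.integral_deriv_smul h1 h2 h3))

lemma HasWeakDeriv.weakDeriv_ae_eq {I : Set ℝ} (hI : IsOpen I) {u v : ℝ → H}
    (h : HasWeakDeriv I u v) : weakDeriv I u =ᵐ[volume.restrict I] v :=
  h.hasWeakDeriv_weakDeriv.ae_eq hI h

/-! ### The Fourier transform in `L²` -/

lemma ae_eq_of_integral_schwartz_smul_eq {f g : ℝ → H} (hf : LocallyIntegrable f)
    (hg : LocallyIntegrable g) (h : ∀ φ : 𝓢(ℝ, ℂ), ∫ t, φ t • f t = ∫ t, φ t • g t) :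
    f =ᵐ[volume] g := by
  refine ae_eq_of_integral_contDiff_smul_eq hf hg fun ψ h1 h2 => ?_
  have h3 : HasCompactSupport (Complex.ofRealCLM ∘ ψ) := h2.comp_left rfl
  have h4 : ContDiff ℝ ∞ (Complex.ofRealCLM ∘ ψ) := by fun_prop
  simpa using h (h3.toSchwartzMap h4)

lemma integral_schwartz_smul_fourier (f : Lp H 2 (volume : Measure ℝ)) (φ : 𝓢(ℝ, ℂ)) :
    ∫ t, φ t • (𝓕 f : Lp H 2 (volume : Measure ℝ)) t = ∫ t, 𝓕 φ t • f t := by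
  have := congrArg (fun F => F φ) (Lp.fourier_toTemperedDistribution_eq f)
  simpa using this.symm

/-- On `L¹ ∩ L²` the Fourier transform of `L²` is given by the Fourier integral. -/
lemma fourier_toLp_ae_eq {f : ℝ → H} (h1 : Integrable f) (h2 : MemLp f 2) :
    (𝓕 (h2.toLp f) : Lp H 2 (volume : Measure ℝ)) =ᵐ[volume] 𝓕 f := by
  refine ae_eq_of_integral_schwartz_smul_eq
    ((Lp.memLp _).locallyIntegrable (by norm_num)) ?_ fun φ => ?_
  · exact (VectorFourier.fourierIntegral_continuous Real.continuous_fourierChar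
      (by exact continuous_inner) h1).locallyIntegrable
  · rw [integral_schwartz_smul_fourier]
    rw [integral_congr_ae (h2.coeFn_toLp.mono fun t ht => congrArg (𝓕 φ t • ·) ht)]
    have := VectorFourier.integral_fourierIntegral_smul_eq_flip (L := innerₗ ℝ)
      Real.continuous_fourierChar (by exact continuous_inner) (φ.integrable (μ := volume)) h1
    simp only [flip_innerₗ] at this
    exact this

lemma fourier_compLp (L : H →L[ℂ] H) (f : Lp H 2 (volume : Measure ℝ)) :
    𝓕 (L.compLp f) = L.compLp (𝓕 f) := by
  have hint : ∀ (g : Lp H 2 (volume : Measure ℝ)) (φ : 𝓢(ℝ, ℂ)),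
      Integrable fun t => φ t • g t := fun g φ =>
    memLp_one_iff_integrable.1 ((Lp.memLp g).smul (φ.memLp 2 volume))
  have hcomp : ∀ (g : Lp H 2 (volume : Measure ℝ)) (φ : 𝓢(ℝ, ℂ)),
      ∫ t, φ t • (L.compLp g) t = L (∫ t, φ t • g t) := by
    intro g φ
    rw [← L.integral_comp_comm (hint g φ)]
    refine integral_congr_ae ((L.coeFn_compLp g).mono fun t ht => ?_)
    simp only [ht, map_smul]
  refine Lp.ext (ae_eq_of_integral_schwartz_smul_eq
    ((Lp.memLp _).locallyIntegrable (by norm_num)) ((Lp.memLp _).locallyIntegrable (by norm_num))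
      fun φ => ?_)
  rw [integral_schwartz_smul_fourier, hcomp, hcomp, integral_schwartz_smul_fourier]

end

/-! ### Energy estimates on the line -/

section

variable {H : Type*} [NormedAddCommGroup H] [InnerProductSpace ℂ H]

/-- The inequalities behind the constants `c₀`, `c₁`, `c₂`: expand `‖V - Q‖²` and bound the cross
term from below by `cos 2ε z²`, where `z² ≤ ‖Q‖ ‖V‖`. In the application `Q = ρ^{-1/2} u''`, `V =
ρ^{1/2} A² u` and `z = ‖A u'‖`. -/
lemma sector_estimates {E : Type*} [NormedAddCommGroup E] [InnerProductSpace ℂ E] {ε : ℝ}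
    (hε₀ : 0 ≤ ε) (hε : ε < Real.pi / 2) (Q V : E) {z : ℝ} (hz : 0 ≤ z)
    (h1 : z ^ 2 ≤ ‖Q‖ * ‖V‖) (h2 : Real.cos (2 * ε) * z ^ 2 ≤ -(inner ℂ Q V).re) :
    ‖V‖ ≤ sectorConst ε * ‖V - Q‖ ∧ ‖Q‖ ≤ sectorConst ε * ‖V - Q‖ ∧
      2 * Real.cos ε * z ≤ ‖V - Q‖ := by
  have hn : ‖V - Q‖ ^ 2 = ‖V‖ ^ 2 + ‖Q‖ ^ 2 - 2 * (inner ℂ Q V).re := by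
    have := norm_sub_sq (𝕜 := ℂ) Q V
    rw [norm_sub_rev, this]
    change _ - 2 * (inner ℂ Q V).re + _ = _
    ring
  have hcos : 0 < Real.cos ε := Real.cos_pos_of_mem_Ioo ⟨by linarith [Real.pi_pos], hε⟩
  have hQ := norm_nonneg Q
  have hV := norm_nonneg V
  have hlow : ‖V‖ ^ 2 + ‖Q‖ ^ 2 + 2 * Real.cos (2 * ε) * z ^ 2 ≤ ‖V - Q‖ ^ 2 := by
    rw [hn]; linarith
  have hκ : ∀ X Y : ℝ, 0 ≤ X → 0 ≤ Y → z ^ 2 ≤ X * Y →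
      X ^ 2 + Y ^ 2 + 2 * Real.cos (2 * ε) * z ^ 2 ≤ ‖V - Q‖ ^ 2 →
      X ≤ sectorConst ε * ‖V - Q‖ := by
    intro X Y hX hY hXY hle
    rw [sectorConst]
    split_ifs with hlt
    · have hc : 0 ≤ Real.cos (2 * ε) :=
        Real.cos_nonneg_of_mem_Icc ⟨by linarith [Real.pi_pos], by linarith⟩
      rw [one_mul]
      refine (sq_le_sq₀ hX (norm_nonneg _)).1 ?_
      nlinarith [mul_nonneg hc (sq_nonneg z)]
    · have hc : Real.cos (2 * ε) ≤ 0 :=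
        Real.cos_nonpos_of_pi_div_two_le_of_le (by linarith) (by linarith)
      have hk : Real.cos (2 * ε) = 2 * Real.cos ε ^ 2 - 1 := Real.cos_two_mul ε
      have h2 : 0 < Real.sqrt 2 * Real.cos ε := by positivity
      rw [div_mul_eq_mul_div, one_mul, le_div_iff₀ h2]
      refine (sq_le_sq₀ (by positivity) (norm_nonneg _)).1 ?_
      rw [mul_pow, mul_pow, Real.sq_sqrt zero_le_two]
      set k := Real.cos (2 * ε)
      have e1 : 2 * k * (X * Y) ≤ 2 * k * z ^ 2 :=
        mul_le_mul_of_nonpos_left hXY (by linarith)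
      have e2 : 0 ≤ (1 + k) * (-k) * X ^ 2 :=
        mul_nonneg (mul_nonneg (by nlinarith) (by linarith)) (sq_nonneg _)
      have e3 : Real.cos ε ^ 2 = (1 + k) / 2 := by linarith
      rw [e3]
      nlinarith [sq_nonneg (Y + k * X)]
  refine ⟨hκ _ _ hV hQ (by linarith [mul_comm ‖Q‖ ‖V‖]) hlow,
    hκ _ _ hQ hV h1 (by linarith), ?_⟩
  · refine (sq_le_sq₀ (by positivity) (norm_nonneg _)).1 ?_
    have : Real.cos (2 * ε) = 2 * Real.cos ε ^ 2 - 1 := Real.cos_two_mul ε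
    nlinarith [sq_nonneg (‖V‖ - ‖Q‖)]

lemma norm_sq_eq_integral {α : Type*} [MeasurableSpace α] {μ : Measure α} (f : Lp H 2 μ) :
    ‖f‖ ^ 2 = ∫ t, ‖f t‖ ^ 2 ∂μ := by
  have h := L2.inner_def (𝕜 := ℂ) f f
  have h2 : ∀ t, inner ℂ (f t) (f t) = ((‖f t‖ ^ 2 : ℝ) : ℂ) := fun t => by
    rw [inner_self_eq_norm_sq_to_K]; push_cast; rfl
  simp only [h2] at h
  rw [inner_self_eq_norm_sq_to_K] at h
  rw [integral_complex_ofReal] at h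
  exact Complex.ofReal_injective (by push_cast; exact h)

lemma norm_toLp_sq {α : Type*} [MeasurableSpace α] {μ : Measure α} {f : α → H}
    (hf : MemLp f 2 μ) : ‖hf.toLp f‖ ^ 2 = ∫ t, ‖f t‖ ^ 2 ∂μ := by
  rw [norm_sq_eq_integral]
  refine integral_congr_ae ?_
  filter_upwards [hf.coeFn_toLp] with t ht
  rw [ht]

variable [CompleteSpace H]

/-- If `v, p, q ∈ L²(ℝ; H)` are such that `p` is the derivative of `T² v` and `q` that of `p`,
then `p = T y` for some `y ∈ L²(ℝ; H)`, which is the derivative of `T v`; the identities `‖y‖² =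
- Re ⟨U q, v⟩` and `cos 2ε ‖y‖² ≤ - Re ⟨q, v⟩` hold where `U T = T*`. Derivatives are expressed
through the Fourier transform, and so no smoothness of `v` is needed to integrate by parts. -/
lemma exists_intermediate_derivative (T U : H →L[ℂ] H) [hT : IsStarNormal T] {ε : ℝ}
    (hε : ε < Real.pi / 2) (hspec : spectrum ℂ T ⊆ sector ε)
    (hU : ∀ x, U (T x) = ContinuousLinearMap.adjoint T x)
    (v p q : Lp H 2 (volume : Measure ℝ))
    (hp : (𝓕 p : Lp H 2 (volume : Measure ℝ)) =ᵐ[volume]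
      fun ξ => (2 * Real.pi * Complex.I * ξ) • T (T ((𝓕 v : Lp H 2 (volume : Measure ℝ)) ξ)))
    (hq : (𝓕 q : Lp H 2 (volume : Measure ℝ)) =ᵐ[volume]
      fun ξ => (2 * Real.pi * Complex.I * ξ) • (𝓕 p : Lp H 2 (volume : Measure ℝ)) ξ) :
    ∃ y : Lp H 2 (volume : Measure ℝ), T.compLp y = p ∧
      (𝓕 y : Lp H 2 (volume : Measure ℝ)) =ᵐ[volume]
        (fun ξ => (2 * Real.pi * Complex.I * ξ) • T ((𝓕 v : Lp H 2 (volume : Measure ℝ)) ξ)) ∧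
      ‖y‖ ^ 2 = -(inner ℂ (U.compLp q) v).re ∧
      Real.cos (2 * ε) * ‖y‖ ^ 2 ≤ -(inner ℂ q v).re := by
  set v' : Lp H 2 (volume : Measure ℝ) := 𝓕 v with hv'
  set p' : Lp H 2 (volume : Measure ℝ) := 𝓕 p with hp'
  set q' : Lp H 2 (volume : Measure ℝ) := 𝓕 q with hq'
  have hq2 : ∀ᵐ ξ, q' ξ = -(((2 * Real.pi * ξ) ^ 2 : ℝ) : ℂ) • T (T (v' ξ)) := by
    filter_upwards [hp, hq] with ξ h1 h2
    rw [h2, h1, smul_smul]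
    congr 1
    push_cast
    linear_combination (4 * Real.pi ^ 2 * ξ ^ 2 : ℂ) * Complex.I_sq
  -- Pointwise form of the two relations.
  have hsq : ∀ᵐ ξ : ℝ, ‖(2 * Real.pi * Complex.I * ξ : ℂ) • T (v' ξ)‖ ^ 2
      = -(inner ℂ (U (q' ξ)) (v' ξ)).re := by
    filter_upwards [hq2] with ξ h
    rw [h, map_smul, hU, inner_smul_left, ContinuousLinearMap.adjoint_inner_left,
      inner_self_eq_norm_sq_to_K, norm_smul, mul_pow]
    have : ‖(2 * Real.pi * Complex.I * ξ : ℂ)‖ ^ 2 = (2 * Real.pi * ξ) ^ 2 := by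
      simp [abs_of_pos Real.pi_pos, mul_pow]
    rw [this, map_neg, Complex.conj_ofReal, neg_mul, Complex.neg_re, neg_neg]
    exact (Complex.ofReal_re _).symm.trans (congrArg Complex.re (by push_cast; rfl))
  have hcos : ∀ᵐ ξ : ℝ, Real.cos (2 * ε) * ‖(2 * Real.pi * Complex.I * ξ : ℂ) • T (v' ξ)‖ ^ 2
      ≤ -(inner ℂ (q' ξ) (v' ξ)).re := by
    filter_upwards [hq2] with ξ h
    rw [h, inner_smul_left, norm_smul, mul_pow]
    have : ‖(2 * Real.pi * Complex.I * ξ : ℂ)‖ ^ 2 = (2 * Real.pi * ξ) ^ 2 := by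
      simp [abs_of_pos Real.pi_pos, mul_pow]
    rw [this, map_neg, Complex.conj_ofReal, neg_mul, Complex.neg_re, neg_neg, Complex.re_ofReal_mul]
    have := cos_mul_norm_sq_le_re_inner T hε hspec (v' ξ)
    nlinarith [mul_le_mul_of_nonneg_left this (sq_nonneg (2 * Real.pi * ξ))]
  have hmeas : AEStronglyMeasurable
      (fun ξ : ℝ => (2 * Real.pi * Complex.I * ξ : ℂ) • T (v' ξ)) volume := by
    refine AEStronglyMeasurable.smul (by fun_prop) ?_
    exact T.continuous.comp_aestronglyMeasurable (Lp.memLp v').1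
  have hUq : ∀ᵐ ξ, (U.compLp q') ξ = U (q' ξ) := U.coeFn_compLp q'
  have hint : Integrable (fun ξ => inner ℂ (U (q' ξ)) (v' ξ)) := by
    refine (L2.integrable_inner (𝕜 := ℂ) (U.compLp q') v').congr ?_
    filter_upwards [hUq] with ξ h
    rw [h]
  have hmem : MemLp (fun ξ : ℝ => (2 * Real.pi * Complex.I * ξ : ℂ) • T (v' ξ)) 2 := by
    rw [memLp_two_iff_integrable_sq_norm hmeas]
    refine hint.re.neg.congr ?_
    filter_upwards [hsq] with ξ h
    exact h.symm
  set y' : Lp H 2 (volume : Measure ℝ) := hmem.toLp _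
  have hy' : y' =ᵐ[volume] fun ξ : ℝ => (2 * Real.pi * Complex.I * ξ : ℂ) • T (v' ξ) :=
    hmem.coeFn_toLp
  have hFy : (𝓕 (𝓕⁻ y' : Lp H 2 (volume : Measure ℝ)) : Lp H 2 (volume : Measure ℝ)) = y' :=
    FourierTransform.fourier_fourierInv_eq y'
  have hFinj : Function.Injective
      (fun f : Lp H 2 (volume : Measure ℝ) => (𝓕 f : Lp H 2 (volume : Measure ℝ))) :=
    (Lp.fourierTransformₗᵢ ℝ H).injective
  have hny : ‖(𝓕⁻ y' : Lp H 2 (volume : Measure ℝ))‖ ^ 2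
      = ∫ ξ : ℝ, ‖(2 * Real.pi * Complex.I * ξ : ℂ) • T (v' ξ)‖ ^ 2 := by
    rw [← Lp.norm_fourier_eq, hFy]
    exact norm_toLp_sq hmem
  refine ⟨𝓕⁻ y', ?_, by rw [hFy]; exact hy', ?_, ?_⟩
  · refine hFinj ?_
    simp only [fourier_compLp, hFy]
    refine Lp.ext ?_
    filter_upwards [T.coeFn_compLp y', hy', hp] with ξ h1 h2 h3
    rw [h1, h2, map_smul, ← h3]
  · rw [hny, integral_congr_ae hsq, integral_neg]
    rw [← Lp.inner_fourier_eq, fourier_compLp, L2.inner_def]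
    have : ∫ ξ, inner ℂ ((U.compLp q') ξ) (v' ξ) = ∫ ξ, inner ℂ (U (q' ξ)) (v' ξ) := by
      refine integral_congr_ae ?_
      filter_upwards [hUq] with ξ h
      rw [h]
    rw [this]
    congr 1
    exact integral_re hint
  · rw [hny, ← Lp.inner_fourier_eq, L2.inner_def, ← integral_const_mul]
    have hi := L2.integrable_inner (𝕜 := ℂ) q' v'
    have : ∫ ξ, (inner ℂ (q' ξ) (v' ξ)).re = (∫ ξ, inner ℂ (q' ξ) (v' ξ)).re := integral_re hi
    rw [← this, ← integral_neg]
    refine integral_mono_ae ?_ hi.re.neg hcos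
    exact ((memLp_two_iff_integrable_sq_norm hmeas).1 hmem).const_mul _

/-- The estimates of `‖A² u‖`, `‖A u'‖`, `‖u''‖` through `‖-u'' + ρ A² u‖` on the line, written with
`v = A² u`, `y = A u'`, `q = u''`. -/
lemma exists_energy_estimates (T U : H →L[ℂ] H) [hT : IsStarNormal T] {ε α β : ℝ}
    (hε₀ : 0 ≤ ε) (hε : ε < Real.pi / 2) (hα : 0 < α) (hβ : 0 < β)
    (hspec : spectrum ℂ T ⊆ sector ε)
    (hU : ∀ x, U (T x) = ContinuousLinearMap.adjoint T x) (hU1 : ‖U‖ ≤ 1)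
    (v p q : Lp H 2 (volume : Measure ℝ))
    (hp : (𝓕 p : Lp H 2 (volume : Measure ℝ)) =ᵐ[volume]
      fun ξ => (2 * Real.pi * Complex.I * ξ) • T (T ((𝓕 v : Lp H 2 (volume : Measure ℝ)) ξ)))
    (hq : (𝓕 q : Lp H 2 (volume : Measure ℝ)) =ᵐ[volume]
      fun ξ => (2 * Real.pi * Complex.I * ξ) • (𝓕 p : Lp H 2 (volume : Measure ℝ)) ξ) :
    ∃ y : Lp H 2 (volume : Measure ℝ), T.compLp y = p ∧
      (𝓕 y : Lp H 2 (volume : Measure ℝ)) =ᵐ[volume]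
        (fun ξ => (2 * Real.pi * Complex.I * ξ) • T ((𝓕 v : Lp H 2 (volume : Measure ℝ)) ξ)) ∧
      ∀ g : Lp H 2 (volume : Measure ℝ), (∀ᵐ t, g t = rho α β t • v t - q t) →
        ‖v‖ ≤ c₀ ε α β * ‖g‖ ∧ ‖y‖ ≤ c₁ ε α β * ‖g‖ ∧ ‖q‖ ≤ c₂ ε α β * ‖g‖ := by
  obtain ⟨y, hy1, hy2, hy3, hy4⟩ := exists_intermediate_derivative T U hε hspec hU v p q hp hq
  refine ⟨y, hy1, hy2, fun g hg => ?_⟩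
  -- Dividing the equation by `√ρ` makes the cross term free of `ρ`.
  set r : ℝ → ℝ := fun t => if t < 1 then α else β with hr
  have hrm : Measurable r := Measurable.ite measurableSet_Iio measurable_const measurable_const
  have hrho : ∀ t, rho α β t = r t * r t := fun t => by
    simp only [hr, rho]; split_ifs <;> ring
  set m := min α β with hm
  set M := max α β with hM
  have hm0 : 0 < m := lt_min hα hβ
  have hmr : ∀ t, m ≤ r t := fun t => by
    simp only [hr]; split_ifs
    exacts [min_le_left _ _, min_le_right _ _]
  have hrM : ∀ t, r t ≤ M := fun t => by
    simp only [hr]; split_ifs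
    exacts [le_max_left _ _, le_max_right _ _]
  have hr0 : ∀ t, 0 < r t := fun t => hm0.trans_le (hmr t)
  have hri : ∀ t, (r t)⁻¹ ≤ m⁻¹ := fun t => inv_anti₀ hm0 (hmr t)
  have hVm : MemLp (fun t => r t • v t) 2 volume := by
    refine (Lp.memLp v).of_le_mul (c := M) (hrm.aestronglyMeasurable.smul (Lp.memLp v).1) ?_
    refine Eventually.of_forall fun t => ?_
    rw [norm_smul, Real.norm_of_nonneg (hr0 t).le]
    exact mul_le_mul_of_nonneg_right (hrM t) (norm_nonneg _)
  have hQm : MemLp (fun t => (r t)⁻¹ • q t) 2 volume := by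
    refine (Lp.memLp q).of_le_mul (c := m⁻¹) (hrm.inv.aestronglyMeasurable.smul (Lp.memLp q).1) ?_
    refine Eventually.of_forall fun t => ?_
    rw [norm_smul, Real.norm_of_nonneg (inv_nonneg.2 (hr0 t).le)]
    exact mul_le_mul_of_nonneg_right (hri t) (norm_nonneg _)
  set V := hVm.toLp _
  set Q := hQm.toLp _
  have hV : ∀ᵐ t, V t = r t • v t := hVm.coeFn_toLp
  have hQ : ∀ᵐ t, Q t = (r t)⁻¹ • q t := hQm.coeFn_toLp
  have hinner : ∀ (x z : H) (t : ℝ), inner ℂ ((r t)⁻¹ • x) (r t • z) = inner ℂ x z := by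
    intro x z t
    have h0 : ((r t : ℝ) : ℂ) ≠ 0 := Complex.ofReal_ne_zero.2 (hr0 t).ne'
    rw [← Complex.coe_smul, ← Complex.coe_smul, inner_smul_left, inner_smul_right,
      Complex.conj_ofReal, Complex.ofReal_inv, ← mul_assoc, inv_mul_cancel₀ h0, one_mul]
  have e1 : inner ℂ Q V = inner ℂ q v := by
    rw [L2.inner_def, L2.inner_def]
    refine integral_congr_ae ?_
    filter_upwards [hV, hQ] with t h1 h2
    rw [h1, h2, hinner]
  have e2 : inner ℂ (U.compLp Q) V = inner ℂ (U.compLp q) v := by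
    rw [L2.inner_def, L2.inner_def]
    refine integral_congr_ae ?_
    filter_upwards [hV, hQ, U.coeFn_compLp Q, U.coeFn_compLp q] with t h1 h2 h3 h4
    rw [h3, h4, h1, h2, ← Complex.coe_smul, map_smul, Complex.coe_smul, hinner]
  have hz : ‖y‖ ^ 2 ≤ ‖Q‖ * ‖V‖ := by
    rw [hy3, ← e2]
    calc -(inner ℂ (U.compLp Q) V).re ≤ ‖(inner ℂ (U.compLp Q) V : ℂ)‖ :=
          (neg_le_abs _).trans (Complex.abs_re_le_norm _)
      _ ≤ ‖U.compLp Q‖ * ‖V‖ := norm_inner_le_norm _ _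
      _ ≤ ‖Q‖ * ‖V‖ := by
          refine mul_le_mul_of_nonneg_right ?_ (norm_nonneg _)
          refine (U.norm_compLp_le Q).trans ?_
          exact mul_le_of_le_one_left (norm_nonneg _) hU1
  rw [← e1] at hy4
  obtain ⟨k1, k2, k3⟩ := sector_estimates hε₀ hε Q V (norm_nonneg y) hz hy4
  have hVQ : ‖V - Q‖ ≤ m⁻¹ * ‖g‖ := by
    refine Lp.norm_le_mul_norm_of_ae_le_mul ?_
    filter_upwards [hV, hQ, hg, Lp.coeFn_sub V Q] with t h1 h2 h3 h4
    have : (V - Q) t = (r t)⁻¹ • g t := by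
      rw [h4, Pi.sub_apply, h1, h2, h3, hrho, smul_sub, smul_smul, inv_mul_cancel_left₀ (hr0 t).ne']
    rw [this, norm_smul, Real.norm_of_nonneg (inv_nonneg.2 (hr0 t).le)]
    exact mul_le_mul_of_nonneg_right (hri t) (norm_nonneg _)
  have hvV : ‖v‖ ≤ m⁻¹ * ‖V‖ := by
    refine Lp.norm_le_mul_norm_of_ae_le_mul ?_
    filter_upwards [hV] with t h1
    rw [h1, norm_smul, Real.norm_of_nonneg (hr0 t).le, ← mul_assoc]
    refine le_mul_of_one_le_left (norm_nonneg _) ?_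
    rw [inv_mul_eq_div, one_le_div hm0]; exact hmr t
  have hqQ : ‖q‖ ≤ M * ‖Q‖ := by
    refine Lp.norm_le_mul_norm_of_ae_le_mul ?_
    filter_upwards [hQ] with t h1
    rw [h1, norm_smul, Real.norm_of_nonneg (inv_nonneg.2 (hr0 t).le), ← mul_assoc]
    refine le_mul_of_one_le_left (norm_nonneg _) ?_
    rw [← div_eq_mul_inv, one_le_div (hr0 t)]; exact hrM t
  have hcos : 0 < Real.cos ε := Real.cos_pos_of_mem_Ioo ⟨by linarith [Real.pi_pos], hε⟩
  have hκ : 0 ≤ sectorConst ε := by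
    rw [sectorConst]; split_ifs <;> positivity
  have hM0 : 0 < M := hα.trans_le (le_max_left _ _)
  have hmin : min (α ^ 2) (β ^ 2) = m ^ 2 := by
    rcases le_total α β with h | h
    · rw [hm, min_eq_left h, min_eq_left (pow_le_pow_left₀ hα.le h 2)]
    · rw [hm, min_eq_right h, min_eq_right (pow_le_pow_left₀ hβ.le h 2)]
  refine ⟨?_, ?_, ?_⟩
  · calc ‖v‖ ≤ m⁻¹ * (sectorConst ε * (m⁻¹ * ‖g‖)) := by
          refine hvV.trans ?_
          gcongr
          exact k1.trans (by gcongr)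
      _ = c₀ ε α β * ‖g‖ := by rw [c₀, hmin]; field_simp
  · calc ‖y‖ ≤ (2 * Real.cos ε)⁻¹ * (m⁻¹ * ‖g‖) := by
          rw [inv_mul_eq_div, le_div_iff₀ (by positivity)]
          linarith [k3.trans hVQ]
      _ = c₁ ε α β * ‖g‖ := by rw [c₁, ← hm]; field_simp
  · calc ‖q‖ ≤ M * (sectorConst ε * (m⁻¹ * ‖g‖)) := by
          refine hqQ.trans ?_
          gcongr
          exact k2.trans (by gcongr)
      _ = c₂ ε α β * ‖g‖ := by rw [c₂, ← hm, ← hM]; field_simp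

end

/-! ### A compactness criterion in `L²` -/

section

variable {H : Type*} [NormedAddCommGroup H] [InnerProductSpace ℂ H]

lemma norm_fourier_sub_le {h : ℝ → H} {D : ℝ} (hi : Integrable h)
    (hs : ∀ t, D < |t| → h t = 0) (ξ η : ℝ) :
    ‖𝓕 h ξ - 𝓕 h η‖ ≤ 2 * Real.pi * D * |ξ - η| * ∫ t, ‖h t‖ := by
  have hint : ∀ ξ : ℝ, Integrable fun t : ℝ =>
      Complex.exp (↑(-2 * Real.pi * t * ξ) * Complex.I) • h t := by
    intro ξ
    refine hi.bdd_smul 1 (by fun_prop) (Eventually.of_forall fun t => ?_)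
    rw [Complex.norm_exp_ofReal_mul_I]
  rw [Real.fourier_real_eq_integral_exp_smul, Real.fourier_real_eq_integral_exp_smul,
    ← integral_sub (hint ξ) (hint η), ← integral_const_mul]
  refine norm_integral_le_of_norm_le (hi.norm.const_mul _) (Eventually.of_forall fun t => ?_)
  by_cases ht : D < |t|
  · simp [hs t ht]
  rw [← sub_smul, norm_smul]
  refine mul_le_mul_of_nonneg_right ?_ (norm_nonneg _)
  have e1 : Complex.exp (↑(-2 * Real.pi * t * ξ) * Complex.I)
      - Complex.exp (↑(-2 * Real.pi * t * η) * Complex.I)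
      = Complex.exp (↑(-2 * Real.pi * t * η) * Complex.I)
        * (Complex.exp (Complex.I * ↑(-2 * Real.pi * t * (ξ - η))) - 1) := by
    rw [mul_sub, ← Complex.exp_add, mul_one]
    congr 2
    push_cast; ring
  rw [e1, norm_mul, Complex.norm_exp_ofReal_mul_I, one_mul]
  refine (Real.norm_exp_I_mul_ofReal_sub_one_le).trans ?_
  rw [Real.norm_eq_abs, abs_mul, abs_mul, abs_mul, abs_neg, abs_two, abs_of_pos Real.pi_pos]
  have := not_lt.1 ht
  gcongr

variable [CompleteSpace H]

/-- The functions `f = T h` in `L²(ℝ; H)` which vanish outside `[-D, D]` and for which the `L²`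
norms of `h` and of the derivative `f'` are at most `C`. That `f'` is the derivative of `f` is
expressed through the Fourier transform. -/
def boundedPrimitives (T : H →L[ℂ] H) (D C : ℝ) : Set (Lp H 2 (volume : Measure ℝ)) :=
  {f | ∃ h f' : Lp H 2 (volume : Measure ℝ), T.compLp h = f ∧ ‖h‖ ≤ C ∧ ‖f'‖ ≤ C ∧
    (𝓕 f' : Lp H 2 (volume : Measure ℝ)) =ᵐ[volume]
      (fun ξ => (2 * Real.pi * Complex.I * ξ) • (𝓕 f : Lp H 2 (volume : Measure ℝ)) ξ) ∧
    ∀ᵐ t, D < |t| → f t = 0}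

/-- The Fourier transform of `f = T h` is `T k`, where `k` is the Fourier transform of `h` cut
off to `[-D, D]`, hence bounded and Lipschitz with constants that depend on `D` and `C` only. -/
lemma exists_lipschitz_fourier {T : H →L[ℂ] H} {D C : ℝ} (hD : 0 < D)
    {f : Lp H 2 (volume : Measure ℝ)} (hf : f ∈ boundedPrimitives T D C) :
    ∃ k : ℝ → H, (∀ ξ, ‖k ξ‖ ≤ Real.sqrt (2 * D) * C) ∧
      (∀ ξ η, ‖k ξ - k η‖ ≤ 2 * Real.pi * D * (Real.sqrt (2 * D) * C) * |ξ - η|) ∧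
      (𝓕 f : Lp H 2 (volume : Measure ℝ)) =ᵐ[volume] fun ξ => T (k ξ) := by
  obtain ⟨h, f', hTh, hh, hf', -, hsupp⟩ := hf
  set K : Set ℝ := Icc (-D) D with hK
  have hKm : MeasurableSet K := measurableSet_Icc
  set h₀ : ℝ → H := K.indicator h with hh₀
  have h2 : MemLp h₀ 2 volume := (Lp.memLp h).indicator hKm
  have hvol : volume K = ENNReal.ofReal (2 * D) := by
    rw [hK, Real.volume_Icc]; congr 1; ring
  have h1 : Integrable h₀ := by
    rw [hh₀, integrable_indicator_iff hKm]
    have : IsFiniteMeasure (volume.restrict K) := ⟨by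
      rw [Measure.restrict_apply_univ, hvol]; exact ENNReal.ofReal_lt_top⟩
    exact ((Lp.memLp h).restrict K).integrable (by norm_num)
  have hnorm : ∫ t, ‖h₀ t‖ ≤ Real.sqrt (2 * D) * C := by
    have i2 : IntegrableOn (fun t => ‖h t‖ ^ 2) K :=
      ((Lp.memLp h).integrable_norm_pow (by norm_num)).integrableOn
    have i1 : IntegrableOn (fun t => ‖h t‖) K := by
      have := h1.norm
      rw [hh₀, ← integrable_indicator_iff hKm] at *
      simpa only [norm_indicator_eq_indicator_norm] using this
    have e0 : ∫ t, ‖h₀ t‖ = ∫ t in K, ‖h t‖ := by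
      rw [hh₀, ← integral_indicator hKm]
      simp only [norm_indicator_eq_indicator_norm]
    have hvr : volume.real K = 2 * D := by
      rw [Measure.real, hvol, ENNReal.toReal_ofReal (by positivity)]
    set a := ∫ t in K, ‖h t‖ with ha
    -- Cauchy–Schwarz, by integrating the square of the deviation from the mean.
    have e1 : 0 ≤ ∫ t in K, (‖h t‖ - a / (2 * D)) ^ 2 := integral_nonneg fun t => sq_nonneg _
    have e2 : ∫ t in K, (‖h t‖ - a / (2 * D)) ^ 2
        = (∫ t in K, ‖h t‖ ^ 2) - a ^ 2 / (2 * D) := by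
      have : ∀ t, (‖h t‖ - a / (2 * D)) ^ 2
          = ‖h t‖ ^ 2 - (2 * (a / (2 * D)) * ‖h t‖ - (a / (2 * D)) ^ 2) := fun t => by ring
      simp only [this]
      have i3 : IntegrableOn (fun _ : ℝ => (a / (2 * D)) ^ 2) K :=
        integrableOn_const (by rw [hvol]; exact ENNReal.ofReal_ne_top)
      have i4 : IntegrableOn (fun t => 2 * (a / (2 * D)) * ‖h t‖) K := i1.const_mul _
      have i5 : IntegrableOn (fun t => 2 * (a / (2 * D)) * ‖h t‖ - (a / (2 * D)) ^ 2) K :=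
        i4.sub i3
      rw [integral_sub i2 i5, integral_sub i4 i3, integral_const_mul, setIntegral_const,
        hvr, ← ha, smul_eq_mul]
      field_simp
      ring
    have e3 : ∫ t in K, ‖h t‖ ^ 2 ≤ C ^ 2 := by
      calc _ ≤ ∫ t, ‖h t‖ ^ 2 := setIntegral_le_integral
            ((Lp.memLp h).integrable_norm_pow (by norm_num))
            (Eventually.of_forall fun t => sq_nonneg _)
        _ = ‖h‖ ^ 2 := (norm_sq_eq_integral h).symm
        _ ≤ C ^ 2 := pow_le_pow_left₀ (norm_nonneg _) hh 2
    rw [e0]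
    have hC : 0 ≤ C := (norm_nonneg _).trans hh
    refine (sq_le_sq₀ (integral_nonneg fun t => norm_nonneg _) (by positivity)).1 ?_
    rw [mul_pow, Real.sq_sqrt (by positivity)]
    have e4 : a ^ 2 / (2 * D) ≤ C ^ 2 := by linarith
    rw [div_le_iff₀ (by positivity)] at e4
    linarith
  have hTh₀ : f =ᵐ[volume] fun t => T (h₀ t) := by
    filter_upwards [hsupp, T.coeFn_compLp h] with t ht1 ht2
    rw [hTh] at ht2
    by_cases hm : t ∈ K
    · rw [hh₀, indicator_of_mem hm, ht2]
    · rw [hh₀, indicator_of_notMem hm, map_zero]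
      exact ht1 (not_le.1 fun hle => hm (abs_le.1 hle))
  refine ⟨𝓕 h₀, fun ξ => ?_, fun ξ η => ?_, ?_⟩
  · exact (VectorFourier.norm_fourierIntegral_le_integral_norm _ _ _ _ _).trans hnorm
  · have := norm_fourier_sub_le (D := D) h1 (fun t ht => ?_) ξ η
    · calc _ ≤ 2 * Real.pi * D * |ξ - η| * ∫ t, ‖h₀ t‖ := this
        _ ≤ 2 * Real.pi * D * |ξ - η| * (Real.sqrt (2 * D) * C) := by gcongr
        _ = _ := by ring
    · rw [hh₀, indicator_of_notMem]
      exact fun hm => ht.not_ge (abs_le.2 hm)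
  · have e1 : f = T.compLp (h2.toLp h₀) := by
      refine Lp.ext ?_
      filter_upwards [hTh₀, T.coeFn_compLp (h2.toLp h₀), h2.coeFn_toLp] with t a1 a2 a3
      rw [a1, a2, a3]
    rw [e1, fourier_compLp]
    filter_upwards [T.coeFn_compLp (𝓕 (h2.toLp h₀)), fourier_toLp_ae_eq h1 h2] with ξ a1 a2
    rw [a1, a2]

/-- If `T` is compact, then functions `T h` with `h` and `(T h)'` bounded in `L²` and with supports
in a fixed interval form a totally bounded set: their Fourier transforms have uniformly small tails
and are uniformly close to step functions with values in the relatively compact image of a ball. -/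
lemma totallyBounded_boundedPrimitives {T : H →L[ℂ] H} (hT : IsCompactOperator T) {D C : ℝ}
    (hD : 0 < D) (hC : 0 < C) : TotallyBounded (boundedPrimitives T D C) := by
  suffices hF : TotallyBounded
      ((fun f : Lp H 2 (volume : Measure ℝ) => (𝓕 f : Lp H 2 (volume : Measure ℝ))) ''
        boundedPrimitives T D C) by
    have := hF.image (Lp.fourierTransformₗᵢ ℝ H).symm.isometry.uniformContinuous
    have e : (Lp.fourierTransformₗᵢ ℝ H).symm '' ((fun f : Lp H 2 (volume : Measure ℝ) =>
        (𝓕 f : Lp H 2 (volume : Measure ℝ))) '' boundedPrimitives T D C)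
        = boundedPrimitives T D C := by
      rw [image_image]
      exact (image_congr fun f _ => (Lp.fourierTransformₗᵢ ℝ H).symm_apply_apply f).trans
        (image_id _)
    rwa [e] at this
  rw [Metric.totallyBounded_iff]
  intro δ hδ
  set C₁ := Real.sqrt (2 * D) * C with hC₁
  have hC₁0 : 0 < C₁ := by positivity
  set L := ‖T‖ * (2 * Real.pi * D * C₁) with hL
  have hL0 : 0 ≤ L := by positivity
  -- `R` makes the tails small, `N` the steps, and `η` the distance to the net.
  obtain ⟨R, hR⟩ : ∃ R : ℕ, C / δ < R := exists_nat_gt _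
  have hR0 : (0 : ℝ) < R := (by positivity : (0:ℝ) < C / δ).trans hR
  obtain ⟨η, hη0, hη⟩ : ∃ η : ℝ, 0 < η ∧ 2 * R * (2 * η) ^ 2 < δ ^ 2 / 2 := by
    refine ⟨δ / (5 * R + 5), by positivity, ?_⟩
    rw [mul_pow, div_pow]
    have : 2 * R * (2 ^ 2 * (δ ^ 2 / (5 * R + 5) ^ 2))
        = δ ^ 2 / 2 * (16 * R / (5 * R + 5) ^ 2) := by
      ring
    rw [this]
    refine mul_lt_of_lt_one_right (by positivity) ?_
    rw [div_lt_one (by positivity)]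
    nlinarith
  obtain ⟨N, hN⟩ : ∃ N : ℕ, L / η < N := exists_nat_gt _
  have hN0 : (0 : ℝ) < N := (by positivity : (0:ℝ) ≤ L / η).trans_lt hN
  have htb : TotallyBounded (T '' Metric.closedBall 0 C₁) :=
    ((hT.isCompact_closure_image_closedBall C₁).totallyBounded).subset subset_closure
  obtain ⟨net, hnet_fin, hnet⟩ := Metric.totallyBounded_iff.1 htb η hη0
  set s : Finset ℤ := Finset.Ico (-(R * N : ℤ)) (R * N) with hs
  have hfloor : ∀ ξ : ℝ, ξ ∈ Ico (-(R : ℝ)) R → ⌊N * ξ⌋ ∈ s := by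
    intro ξ hξ
    rw [hs, Finset.mem_Ico, Int.le_floor, Int.floor_lt]
    push_cast
    constructor <;> nlinarith [hξ.1, hξ.2]
  -- The step function with values `c`.
  set step : (s → net) → ℝ → H := fun c ξ =>
    (Ico (-(R : ℝ)) R).indicator (fun ξ => if h : ⌊N * ξ⌋ ∈ s then (c ⟨_, h⟩ : H) else 0) ξ
    with hstep
  have hstepm : ∀ c, MemLp (step c) 2 volume := by
    intro c
    obtain ⟨B, hB⟩ := hnet_fin.isBounded.exists_norm_le
    have : IsFiniteMeasure (volume.restrict (Ico (-(R : ℝ)) R)) := ⟨by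
      rw [Measure.restrict_apply_univ, Real.volume_Ico]; exact ENNReal.ofReal_lt_top⟩
    refine (memLp_indicator_iff_restrict measurableSet_Ico).2 (MemLp.of_bound ?_ (max B 0)
      (Eventually.of_forall fun ξ => ?_))
    · exact ((StronglyMeasurable.of_discrete (f := fun j : ℤ =>
        if h : j ∈ s then (c ⟨_, h⟩ : H) else 0)).comp_measurable
          (Int.measurable_floor.comp (measurable_const_mul (N : ℝ)))).aestronglyMeasurable
    · split_ifs with h
      · exact (hB _ (c ⟨_, h⟩).2).trans (le_max_left _ _)
      · simp
  have : Finite net := hnet_fin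
  refine ⟨range fun c => (hstepm c).toLp (step c), finite_range _, ?_⟩
  rintro _ ⟨f, hf, rfl⟩
  obtain ⟨k, hk1, hk2, hk3⟩ := exists_lipschitz_fourier hD hf
  obtain ⟨h, f', -, -, hf', hfd, -⟩ := hf
  have hc : ∀ j : ℤ, ∃ x : net, ‖T (k (j / N)) - x‖ < η := by
    intro j
    have := hnet ⟨k (j / N), mem_closedBall_zero_iff.2 (hk1 _), rfl⟩
    simp only [mem_iUnion, Metric.mem_ball, dist_eq_norm] at this
    obtain ⟨x, hx, hlt⟩ := this
    exact ⟨⟨x, hx⟩, hlt⟩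
  choose c hcη using hc
  simp only [mem_iUnion, mem_range, exists_prop, exists_exists_eq_and, Metric.mem_ball,
    dist_eq_norm]
  refine ⟨fun j => c j, ?_⟩
  set F := (𝓕 f : Lp H 2 (volume : Measure ℝ)) with hF
  set F' := (𝓕 f' : Lp H 2 (volume : Measure ℝ)) with hF'
  set G := (hstepm fun j => c j).toLp (step fun j => c j) with hG
  have hnear : ∀ᵐ ξ, ‖(F - G) ξ‖ ^ 2 ≤ (Ico (-(R : ℝ)) R).indicator (fun _ => (2 * η) ^ 2) ξ
      + (1 / (2 * Real.pi * R) ^ 2) * ‖F' ξ‖ ^ 2 := by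
    filter_upwards [Lp.coeFn_sub F G, (hstepm fun j => c j).coeFn_toLp, hk3, hfd]
      with ξ a1 a2 a3 a4
    rw [a1, Pi.sub_apply, a2]
    by_cases hξ : ξ ∈ Ico (-(R : ℝ)) R
    · rw [indicator_of_mem hξ, hstep]
      simp only
      rw [indicator_of_mem hξ, dif_pos (hfloor ξ hξ), a3]
      refine le_add_of_le_of_nonneg ?_ (by positivity)
      refine pow_le_pow_left₀ (norm_nonneg _) ?_ 2
      have b1 := (hcη ⌊N * ξ⌋).le
      have b2 : ‖T (k ξ) - T (k (⌊N * ξ⌋ / N))‖ ≤ η := by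
        rw [← map_sub]
        have b3 : |ξ - ⌊N * ξ⌋ / N| ≤ 1 / N := by
          have f1 := Int.floor_le (N * ξ)
          have f2 := (Int.lt_floor_add_one (N * ξ)).le
          have : ξ - ⌊N * ξ⌋ / N = (N * ξ - ⌊N * ξ⌋) / N := by field_simp
          rw [this, abs_div, abs_of_pos hN0, abs_of_nonneg (by linarith)]
          gcongr; linarith
        calc _ ≤ ‖T‖ * (2 * Real.pi * D * C₁ * |ξ - ⌊N * ξ⌋ / N|) :=
              (T.le_opNorm _).trans (by gcongr; exact hk2 _ _)
          _ ≤ ‖T‖ * (2 * Real.pi * D * C₁ * (1 / N)) := by gcongr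
          _ = L / N := by rw [hL]; ring
          _ ≤ η := by
            rw [div_le_iff₀ hN0]
            rw [div_lt_iff₀ hη0] at hN
            linarith
      calc _ ≤ ‖T (k ξ) - T (k (⌊N * ξ⌋ / N))‖ + ‖T (k (⌊N * ξ⌋ / N)) - c ⌊N * ξ⌋‖ :=
            norm_sub_le_norm_sub_add_norm_sub ..
        _ ≤ 2 * η := by linarith
    · rw [indicator_of_notMem hξ, hstep]
      simp only
      rw [indicator_of_notMem hξ, sub_zero, zero_add, a4, norm_smul,
        mul_pow ‖(2 * Real.pi * Complex.I * ξ : ℂ)‖]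
      have b1 : ‖(2 * Real.pi * Complex.I * ξ : ℂ)‖ ^ 2 = (2 * Real.pi * |ξ|) ^ 2 := by
        simp [abs_of_pos Real.pi_pos, mul_pow]
      have b2 : (R : ℝ) ≤ |ξ| := by
        by_contra hlt
        have := abs_lt.1 (not_le.1 hlt)
        exact hξ ⟨this.1.le, this.2⟩
      rw [b1, ← mul_assoc]
      refine le_mul_of_one_le_left (by positivity) ?_
      rw [one_div_mul_eq_div, one_le_div (by positivity)]
      gcongr
  have hsq : ‖F - G‖ ^ 2 < δ ^ 2 := by
    have i1 : Integrable ((Ico (-(R : ℝ)) R).indicator fun _ => (2 * η) ^ 2) := by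
      rw [integrable_indicator_iff measurableSet_Ico]
      exact integrableOn_const (by simp)
    have i2 : Integrable fun ξ => ‖F' ξ‖ ^ 2 := (Lp.memLp F').integrable_norm_pow (by norm_num)
    calc ‖F - G‖ ^ 2 = ∫ ξ, ‖(F - G) ξ‖ ^ 2 := norm_sq_eq_integral _
      _ ≤ ∫ ξ, ((Ico (-(R : ℝ)) R).indicator (fun _ => (2 * η) ^ 2) ξ
          + (1 / (2 * Real.pi * R) ^ 2) * ‖F' ξ‖ ^ 2) :=
        integral_mono_ae ((Lp.memLp (F - G)).integrable_norm_pow (by norm_num))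
          (i1.add (i2.const_mul _)) hnear
      _ = 2 * R * (2 * η) ^ 2 + (1 / (2 * Real.pi * R) ^ 2) * ‖F'‖ ^ 2 := by
        rw [integral_add i1 (i2.const_mul _), integral_const_mul, ← norm_sq_eq_integral,
          integral_indicator measurableSet_Ico, setIntegral_const]
        simp [Measure.real, Real.volume_Ico]
        left
        ring
      _ < δ ^ 2 := by
        have b1 : ‖F'‖ ≤ C := by rw [hF', Lp.norm_fourier_eq]; exact hf'
        have b2 : ‖F'‖ ^ 2 ≤ (R * δ) ^ 2 := by
          refine pow_le_pow_left₀ (norm_nonneg _) (b1.trans ?_) 2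
          rw [div_lt_iff₀ hδ] at hR; exact hR.le
        have b3 : 1 / (2 * Real.pi * R) ^ 2 * ‖F'‖ ^ 2 ≤ δ ^ 2 / 2 := by
          rw [one_div_mul_eq_div, div_le_iff₀ (by positivity)]
          refine b2.trans ?_
          have : 1 ≤ Real.pi ^ 2 := by nlinarith [Real.pi_gt_three]
          nlinarith [mul_le_mul_of_nonneg_left this (sq_nonneg (R * δ))]
        linarith
  exact (sq_lt_sq₀ (norm_nonneg _) hδ.le).1 hsq

end

/-! ### Localization of solutions -/

section

variable {H : Type*} [NormedAddCommGroup H] [InnerProductSpace ℂ H]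

lemma memLp_cutoff_smul {J : Set ℝ} (hJ : MeasurableSet J) {θ : ℝ → ℝ} {κ : ℝ} {f : ℝ → H}
    (hθ : Continuous θ) (hs : tsupport θ ⊆ J) (hκ : ∀ t, ‖θ t‖ ≤ κ)
    (hf : MemLp f 2 (volume.restrict J)) : MemLp (fun t => θ t • f t) 2 := by
  have e : (fun t => θ t • f t) = J.indicator fun t => θ t • f t := by
    refine (indicator_eq_self.2 fun t ht => hs (subset_tsupport _ ?_)).symm
    exact fun h => ht (by simp [h])
  rw [e, memLp_indicator_iff_restrict hJ]
  refine hf.of_le_mul (c := κ) (hθ.aestronglyMeasurable.smul hf.1)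
    (Eventually.of_forall fun t => ?_)
  rw [norm_smul]
  exact mul_le_mul_of_nonneg_right (hκ t) (norm_nonneg _)

lemma norm_toLp_cutoff_smul_le {J : Set ℝ} (hJ : MeasurableSet J) {θ : ℝ → ℝ} {κ c : ℝ}
    {f : ℝ → H} (hθ : Continuous θ) (hs : tsupport θ ⊆ J) (hκ : ∀ t, ‖θ t‖ ≤ κ)
    (hf : MemLp f 2 (volume.restrict J)) (hc : 0 ≤ c) (hfc : ∫ t in J, ‖f t‖ ^ 2 ≤ c ^ 2) :
    ‖(memLp_cutoff_smul hJ hθ hs hκ hf).toLp _‖ ≤ κ * c := by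
  have hκ0 : 0 ≤ κ := (norm_nonneg _).trans (hκ 0)
  refine (sq_le_sq₀ (norm_nonneg _) (by positivity)).1 ?_
  rw [norm_toLp_sq, mul_pow]
  have e : ∫ t, ‖θ t • f t‖ ^ 2 = ∫ t in J, ‖θ t • f t‖ ^ 2 := by
    refine (setIntegral_eq_integral_of_forall_compl_eq_zero fun t ht => ?_).symm
    rw [image_eq_zero_of_notMem_tsupport fun h => ht (hs h)]; simp
  rw [e]
  calc ∫ t in J, ‖θ t • f t‖ ^ 2 ≤ ∫ t in J, κ ^ 2 * ‖f t‖ ^ 2 := by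
        refine integral_mono_of_nonneg (Eventually.of_forall fun t => sq_nonneg _)
          ((hf.integrable_norm_pow (by norm_num)).const_mul _) (Eventually.of_forall fun t => ?_)
        simp only [norm_smul, mul_pow]
        exact mul_le_mul_of_nonneg_right (pow_le_pow_left₀ (norm_nonneg _) (hκ t) 2)
          (sq_nonneg _)
    _ = κ ^ 2 * ∫ t in J, ‖f t‖ ^ 2 := integral_const_mul ..
    _ ≤ κ ^ 2 * c ^ 2 := by gcongr

/-- A smooth cutoff function, together with a bound for its first two derivatives. -/
lemma exists_cutoff {a a₁ b₁ b : ℝ} (h₁ : a < a₁) (h₂ : a₁ < b₁) (h₃ : b₁ < b) :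
    ∃ (χ : ℝ → ℝ) (κ : ℝ), ContDiff ℝ ∞ χ ∧ HasCompactSupport χ ∧ tsupport χ ⊆ Ioo a b ∧
      (∀ t ∈ Ioo a₁ b₁, χ t = 1 ∧ deriv χ t = 0) ∧
      ∀ t, ‖χ t‖ ≤ κ ∧ ‖deriv χ t‖ ≤ κ ∧ ‖deriv (deriv χ) t‖ ≤ κ := by
  set d := min (a₁ - a) (b - b₁) / 2 with hd
  have hmin : 0 < min (a₁ - a) (b - b₁) := lt_min (by linarith) (by linarith)
  have hd1 : d < a₁ - a := by have := min_le_left (a₁ - a) (b - b₁); linarith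
  have hd2 : d < b - b₁ := by have := min_le_right (a₁ - a) (b - b₁); linarith
  let φ : ContDiffBump ((a₁ + b₁) / 2) :=
    ⟨(b₁ - a₁) / 2, (b₁ - a₁) / 2 + d, by linarith, by linarith⟩
  have hφ : ContDiff ℝ ∞ φ := φ.contDiff
  have hφ' : ContDiff ℝ ∞ (deriv φ) := by
    have := (contDiff_infty_iff_deriv.1 hφ).2
    exact this
  have hc : HasCompactSupport φ := φ.hasCompactSupport
  obtain ⟨k0, hk0⟩ := hφ.continuous.bounded_above_of_compact_support hc
  obtain ⟨k1, hk1⟩ := hφ'.continuous.bounded_above_of_compact_support hc.deriv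
  obtain ⟨k2, hk2⟩ := (hφ'.continuous_deriv (by simp)).bounded_above_of_compact_support
    hc.deriv.deriv
  refine ⟨φ, max k0 (max k1 k2), hφ, hc, ?_, ?_, fun t => ⟨(hk0 t).trans (le_max_left _ _),
    (hk1 t).trans ((le_max_left _ _).trans (le_max_right _ _)),
    (hk2 t).trans ((le_max_right _ _).trans (le_max_right _ _))⟩⟩
  · rw [φ.tsupport_eq, Real.closedBall_eq_Icc]
    change Icc ((a₁ + b₁) / 2 - ((b₁ - a₁) / 2 + d)) ((a₁ + b₁) / 2 + ((b₁ - a₁) / 2 + d)) ⊆ _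
    exact Icc_subset_Ioo (by linarith) (by linarith)
  · have h1 : ∀ t ∈ Ioo a₁ b₁, φ t = 1 := by
      intro t ht
      refine φ.one_of_mem_closedBall ?_
      rw [Real.closedBall_eq_Icc]
      change t ∈ Icc ((a₁ + b₁) / 2 - (b₁ - a₁) / 2) ((a₁ + b₁) / 2 + (b₁ - a₁) / 2)
      exact ⟨by linarith [ht.1], by linarith [ht.2]⟩
    intro t ht
    refine ⟨h1 t ht, ?_⟩
    have : (φ : ℝ → ℝ) =ᶠ[𝓝 t] fun _ => 1 := by
      filter_upwards [isOpen_Ioo.mem_nhds ht] with s hs using h1 s hs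
    rw [this.deriv_eq, deriv_const]

lemma fourier_add {f g : ℝ → H} (hf : Integrable f) (hg : Integrable g) (ξ : ℝ) :
    𝓕 (fun t => f t + g t) ξ = 𝓕 f ξ + 𝓕 g ξ :=
  (congrFun (VectorFourier.fourierIntegral_add Real.continuous_fourierChar
    (by exact continuous_inner) hf hg) ξ)

/-- The Fourier transform of the second derivative of a localized function `χ u`. -/
lemma HasWeakDeriv.fourier_cutoff_deriv {I : Set ℝ} {u u' u'' : ℝ → H} (h : HasWeakDeriv I u u')
    (h' : HasWeakDeriv I u' u'') {χ : ℝ → ℝ} (hχ : ContDiff ℝ ∞ χ) (hc : HasCompactSupport χ)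
    (hI : tsupport χ ⊆ I) (ξ : ℝ) :
    𝓕 (fun t => (deriv (deriv χ) t • u t + deriv χ t • u' t)
        + (deriv χ t • u' t + χ t • u'' t)) ξ
      = (2 * Real.pi * Complex.I * ξ) • 𝓕 (fun t => deriv χ t • u t + χ t • u' t) ξ := by
  have hχ' : ContDiff ℝ ∞ (deriv χ) := (contDiff_infty_iff_deriv.1 hχ).2
  have hI' : tsupport (deriv χ) ⊆ I := tsupport_deriv_subset.trans hI
  have hI'' : tsupport (deriv (deriv χ)) ⊆ I := tsupport_deriv_subset.trans hI'
  have i1 := integrable_smul_of_tsupport_subset h.1 (hχ'.continuous_deriv (by simp)) hc.deriv.deriv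
    hI''
  have i2 := integrable_smul_of_tsupport_subset h.2.1 hχ'.continuous hc.deriv hI'
  have i3 := integrable_smul_of_tsupport_subset h'.2.1 hχ.continuous hc hI
  have i4 := integrable_smul_of_tsupport_subset h.1 hχ'.continuous hc.deriv hI'
  have i5 := integrable_smul_of_tsupport_subset h.2.1 hχ.continuous hc hI
  have i12 : Integrable fun t => deriv (deriv χ) t • u t + deriv χ t • u' t := i1.add i2
  have i23 : Integrable fun t => deriv χ t • u' t + χ t • u'' t := i2.add i3
  rw [fourier_add i12 i23, h.fourier_cutoff hχ' hc.deriv hI',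
    h'.fourier_cutoff hχ hc hI, fourier_add i4 i5, smul_add]

end

section

variable {H : Type*} [NormedAddCommGroup H] [InnerProductSpace ℂ H] [CompleteSpace H]

/-- Interior estimate: if `u` solves the equation on `J = (a, b)` and its norm in `W_2^1(J; H)`
is at most `M`, then the derivative `P` of `χ u` and `X = A (χ u)` are bounded primitives, with a
bound that depends on `u` through `M` only. Here `x = A u`, `s = A² u`. -/
lemma mem_boundedPrimitives_of_solution (T U : H →L[ℂ] H) [hT : IsStarNormal T]
    (hTi : Function.Injective T) {ε α β : ℝ}
    (hε₀ : 0 ≤ ε) (hε : ε < Real.pi / 2) (hα : 0 < α) (hβ : 0 < β)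
    (hspec : spectrum ℂ T ⊆ sector ε)
    (hU : ∀ x, U (T x) = ContinuousLinearMap.adjoint T x) (hU1 : ‖U‖ ≤ 1)
    (B₀ B₁ B₂ : H →L[ℂ] H)
    (hsmall : c₀ ε α β * ‖B₂‖ + c₁ ε α β * ‖B₁‖ + c₂ ε α β * ‖B₀‖ < 1)
    {a b : ℝ} (ha : 0 < a) {χ : ℝ → ℝ} {κ : ℝ} (hχ : ContDiff ℝ ∞ χ) (hc : HasCompactSupport χ)
    (hJ : tsupport χ ⊆ Ioo a b)
    (hκ : ∀ t, ‖χ t‖ ≤ κ ∧ ‖deriv χ t‖ ≤ κ ∧ ‖deriv (deriv χ) t‖ ≤ κ)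
    {u u₁ u₂ s x : ℝ → H} {M K C : ℝ} (hM : 0 ≤ M)
    (h₁ : HasWeakDeriv (Ioo a b) u u₁) (h₂ : HasWeakDeriv (Ioo a b) u₁ u₂)
    (mu₁ : MemLp u₁ 2 (volume.restrict (Ioo a b))) (mu₂ : MemLp u₂ 2 (volume.restrict (Ioo a b)))
    (ms : MemLp s 2 (volume.restrict (Ioo a b))) (mx : MemLp x 2 (volume.restrict (Ioo a b)))
    (hu₁M : ∫ t in Ioo a b, ‖u₁ t‖ ^ 2 ≤ M ^ 2) (hxM : ∫ t in Ioo a b, ‖x t‖ ^ 2 ≤ M ^ 2)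
    (hu : ∀ᵐ t ∂(volume.restrict (Ioo a b)), u t = T (x t))
    (hx : ∀ᵐ t ∂(volume.restrict (Ioo a b)), x t = T (s t))
    (heq : ∀ᵐ t ∂(volume.restrict (Ioo a b)), ∀ y, u₁ t = T y →
      -u₂ t + rho α β t • s t + B₀ (u₂ t) + B₁ y + B₂ (s t) = 0)
    (hK : K = (‖B₀‖ + 1) * (κ * (‖T‖ * M) + 2 * (κ * M)) + ‖B₁‖ * (κ * M))
    (hC : C = (c₀ ε α β + c₁ ε α β + c₂ ε α β)
      * (K / (1 - (c₀ ε α β * ‖B₂‖ + c₁ ε α β * ‖B₁‖ + c₂ ε α β * ‖B₀‖))) + 1) :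
    ∃ P X : Lp H 2 (volume : Measure ℝ), P ∈ boundedPrimitives T b C ∧
      X ∈ boundedPrimitives T b C ∧
      (∀ᵐ t, P t = deriv χ t • u t + χ t • u₁ t) ∧
      ∀ᵐ t ∂(volume.restrict (Ioo a b)), X t = χ t • x t := by
  have hJm : MeasurableSet (Ioo a b) := measurableSet_Ioo
  have hχ' : ContDiff ℝ ∞ (deriv χ) := (contDiff_infty_iff_deriv.1 hχ).2
  have hJ' : tsupport (deriv χ) ⊆ Ioo a b := tsupport_deriv_subset.trans hJ
  have hJ'' : tsupport (deriv (deriv χ)) ⊆ Ioo a b := tsupport_deriv_subset.trans hJ'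
  have cχ := hχ.continuous
  have cχ' := hχ'.continuous
  have cχ'' := hχ'.continuous_deriv (by simp)
  have hκ0 : 0 ≤ κ := (norm_nonneg _).trans (hκ 0).1
  have mu : MemLp u 2 (volume.restrict (Ioo a b)) :=
    (T.comp_memLp' mx).ae_eq (hu.mono fun t ht => ht.symm)
  have huM : ∫ t in Ioo a b, ‖u t‖ ^ 2 ≤ (‖T‖ * M) ^ 2 := by
    calc ∫ t in Ioo a b, ‖u t‖ ^ 2 ≤ ∫ t in Ioo a b, ‖T‖ ^ 2 * ‖x t‖ ^ 2 := by
          refine integral_mono_ae (mu.integrable_norm_pow (by norm_num))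
            ((mx.integrable_norm_pow (by norm_num)).const_mul _) ?_
          filter_upwards [hu] with t ht
          rw [ht, ← mul_pow]
          exact pow_le_pow_left₀ (norm_nonneg _) (T.le_opNorm _) 2
      _ = ‖T‖ ^ 2 * ∫ t in Ioo a b, ‖x t‖ ^ 2 := integral_const_mul ..
      _ ≤ (‖T‖ * M) ^ 2 := by rw [mul_pow]; gcongr
  -- The localized functions.
  have m0 := memLp_cutoff_smul hJm cχ hJ (fun t => (hκ t).1) ms
  have m1 := memLp_cutoff_smul hJm cχ hJ (fun t => (hκ t).1) mu
  have m2 := memLp_cutoff_smul hJm cχ' hJ' (fun t => (hκ t).2.1) mu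
  have m3 := memLp_cutoff_smul hJm cχ hJ (fun t => (hκ t).1) mu₁
  have m4 := memLp_cutoff_smul hJm cχ'' hJ'' (fun t => (hκ t).2.2) mu
  have m5 := memLp_cutoff_smul hJm cχ' hJ' (fun t => (hκ t).2.1) mu₁
  have m6 := memLp_cutoff_smul hJm cχ hJ (fun t => (hκ t).1) mu₂
  have m7 := memLp_cutoff_smul hJm cχ' hJ' (fun t => (hκ t).2.1) mx
  have i1 := integrable_smul_of_tsupport_subset h₁.1 cχ hc hJ
  have i2 := integrable_smul_of_tsupport_subset h₁.1 cχ' hc.deriv hJ'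
  have i3 := integrable_smul_of_tsupport_subset h₁.2.1 cχ hc hJ
  have i4 := integrable_smul_of_tsupport_subset h₁.1 cχ'' hc.deriv.deriv hJ''
  have i5 := integrable_smul_of_tsupport_subset h₁.2.1 cχ' hc.deriv hJ'
  have i6 := integrable_smul_of_tsupport_subset h₂.2.1 cχ hc hJ
  have mp : MemLp (fun t => deriv χ t • u t + χ t • u₁ t) 2 := m2.add m3
  have ip : Integrable (fun t => deriv χ t • u t + χ t • u₁ t) := i2.add i3
  have mq : MemLp (fun t => (deriv (deriv χ) t • u t + deriv χ t • u₁ t)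
      + (deriv χ t • u₁ t + χ t • u₂ t)) 2 := (m4.add m5).add (m5.add m6)
  have iq : Integrable (fun t => (deriv (deriv χ) t • u t + deriv χ t • u₁ t)
      + (deriv χ t • u₁ t + χ t • u₂ t)) := (i4.add i5).add (i5.add i6)
  set v := m0.toLp _ with hv
  set w := m1.toLp _ with hw
  set p := mp.toLp _ with hp
  set q := mq.toLp _ with hq
  have hoff : ∀ {f : ℝ → ℝ}, tsupport f ⊆ Ioo a b → ∀ t ∉ Ioo a b, f t = 0 := fun hf t ht =>
    image_eq_zero_of_notMem_tsupport fun h => ht (hf h)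
  have hu' := (ae_restrict_iff' hJm).1 hu
  have hx' := (ae_restrict_iff' hJm).1 hx
  have heq' := (ae_restrict_iff' hJm).1 heq
  have hwv : w = T.compLp (T.compLp v) := by
    refine Lp.ext ?_
    filter_upwards [m1.coeFn_toLp, T.coeFn_compLp (T.compLp v), T.coeFn_compLp v, m0.coeFn_toLp,
      hu', hx'] with t k1 k2 k3 k4 k5 k6
    rw [k1, k2, k3, k4]
    by_cases ht : t ∈ Ioo a b
    · rw [k5 ht, k6 ht, T.map_smul_of_tower, T.map_smul_of_tower]
    · rw [hoff hJ t ht]; simp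
  have hFp : (𝓕 p : Lp H 2 (volume : Measure ℝ)) =ᵐ[volume]
      fun ξ => (2 * Real.pi * Complex.I * ξ) • T (T ((𝓕 v : Lp H 2 (volume : Measure ℝ)) ξ)) := by
    have hFw : (𝓕 w : Lp H 2 (volume : Measure ℝ)) = T.compLp (T.compLp (𝓕 v)) := by
      rw [hwv, fourier_compLp, fourier_compLp]
    filter_upwards [fourier_toLp_ae_eq ip mp, fourier_toLp_ae_eq i1 m1,
      T.coeFn_compLp (T.compLp (𝓕 v)), T.coeFn_compLp (𝓕 v)] with ξ k1 k2 k3 k4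
    rw [k1, h₁.fourier_cutoff hχ hc hJ, ← k2, ← hw, hFw, k3, k4]
  have hFq : (𝓕 q : Lp H 2 (volume : Measure ℝ)) =ᵐ[volume]
      fun ξ => (2 * Real.pi * Complex.I * ξ) • (𝓕 p : Lp H 2 (volume : Measure ℝ)) ξ := by
    filter_upwards [fourier_toLp_ae_eq ip mp, fourier_toLp_ae_eq iq mq] with ξ k1 k2
    rw [k1, k2, h₁.fourier_cutoff_deriv h₂ hχ hc hJ]
  obtain ⟨y, hy1, hy2, hy3⟩ :=
    exists_energy_estimates T U hε₀ hε hα hβ hspec hU hU1 v p q hFp hFq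
  -- The commutator terms.
  set e₁ := m4.toLp _ with he₁
  set e₂ := m5.toLp _ with he₂
  set e₃ := m7.toLp _ with he₃
  set e := e₁ + (e₂ + e₂) with he
  set g := (B₀.compLp e + B₁.compLp e₃ - e) - B₀.compLp q - B₁.compLp y - B₂.compLp v with hg
  have hgeq : ∀ᵐ t, g t = rho α β t • v t - q t := by
    filter_upwards [Lp.coeFn_sub ((B₀.compLp e + B₁.compLp e₃ - e) - B₀.compLp q - B₁.compLp y)
        (B₂.compLp v), Lp.coeFn_sub ((B₀.compLp e + B₁.compLp e₃ - e) - B₀.compLp q) (B₁.compLp y),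
      Lp.coeFn_sub (B₀.compLp e + B₁.compLp e₃ - e) (B₀.compLp q),
      Lp.coeFn_sub (B₀.compLp e + B₁.compLp e₃) e, Lp.coeFn_add (B₀.compLp e) (B₁.compLp e₃),
      Lp.coeFn_add e₁ (e₂ + e₂), Lp.coeFn_add e₂ e₂, B₀.coeFn_compLp e, B₁.coeFn_compLp e₃,
      B₀.coeFn_compLp q, B₁.coeFn_compLp y, B₂.coeFn_compLp v, m4.coeFn_toLp, m5.coeFn_toLp,
      m7.coeFn_toLp, mq.coeFn_toLp, mp.coeFn_toLp, m0.coeFn_toLp, T.coeFn_compLp y, hu', heq']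
      with t k1 k2 k3 k4 k5 k6 k7 k8 k9 k10 k11 k12 k13 k14 k15 k16 k17 k18 k19 k20 k21
    have hTy : T (y t) = deriv χ t • u t + χ t • u₁ t := by
      rw [← k19, hy1, hp, k17]
    have het : e t = deriv (deriv χ) t • u t + (deriv χ t • u₁ t + deriv χ t • u₁ t) := by
      rw [he, k6, Pi.add_apply, k7, Pi.add_apply, k13, k14]
    rw [hg, k1, Pi.sub_apply, k2, Pi.sub_apply, k3, Pi.sub_apply, k4, Pi.sub_apply, k5,
      Pi.add_apply, k8, k9, k10, k11, k12, k15, k16, k18, het]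
    by_cases ht : t ∈ Ioo a b
    · -- `χ u₁ = T z`, so that `χ A₁ u₁ = B₁ z`.
      have hz : T (y t - deriv χ t • x t) = χ t • u₁ t := by
        rw [map_sub, hTy, k20 ht, T.map_smul_of_tower, add_sub_cancel_left]
      have hmain : χ t • (-u₂ t + rho α β t • s t + B₀ (u₂ t) + B₂ (s t))
          + B₁ (y t - deriv χ t • x t) = 0 := by
        by_cases h0 : χ t = 0
        · rw [h0, zero_smul] at hz
          rw [hTi (hz.trans (map_zero T).symm), h0, map_zero, zero_smul, add_zero]
        · have h0' : ((χ t : ℝ) : ℂ) ≠ 0 := Complex.ofReal_ne_zero.2 h0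
          have := k21 ht (((χ t : ℝ) : ℂ)⁻¹ • (y t - deriv χ t • x t)) (by
            rw [map_smul, hz, ← Complex.coe_smul, inv_smul_smul₀ h0'])
          have h3 := congrArg (fun z => ((χ t : ℝ) : ℂ) • z) this
          simp only [map_smul, smul_add, smul_inv_smul₀ h0', smul_zero] at h3
          rw [← h3]
          simp only [Complex.coe_smul, smul_add]
          abel
      rw [map_sub, B₁.map_smul_of_tower] at hmain
      simp only [map_add, ContinuousLinearMap.map_smul_of_tower]
      linear_combination (norm := module) (-1 : ℝ) • hmain
    · have hy0 : y t = 0 := by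
        refine hTi ?_
        rw [hTy, hoff hJ t ht, hoff hJ' t ht]; simp
      rw [hy0, hoff hJ t ht, hoff hJ' t ht, hoff hJ'' t ht]; simp
  obtain ⟨bv, byy, bq⟩ := hy3 g hgeq
  -- The smallness condition absorbs the terms with `q`, `y`, `v`.
  have be : ‖e‖ ≤ κ * (‖T‖ * M) + 2 * (κ * M) := by
    have b1 : ‖e₁‖ ≤ κ * (‖T‖ * M) := norm_toLp_cutoff_smul_le hJm cχ'' hJ''
      (fun t => (hκ t).2.2) mu (by positivity) huM
    have b2 : ‖e₂‖ ≤ κ * M := norm_toLp_cutoff_smul_le hJm cχ' hJ'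
      (fun t => (hκ t).2.1) mu₁ hM hu₁M
    have := norm_add_le e₁ (e₂ + e₂)
    have := norm_add_le e₂ e₂
    rw [he]; linarith
  have be₃ : ‖e₃‖ ≤ κ * M := norm_toLp_cutoff_smul_le hJm cχ' hJ'
    (fun t => (hκ t).2.1) mx hM hxM
  have hf : ‖B₀.compLp e + B₁.compLp e₃ - e‖ ≤ K := by
    calc _ ≤ ‖B₀.compLp e‖ + ‖B₁.compLp e₃‖ + ‖e‖ :=
          (norm_sub_le _ _).trans (add_le_add_left (norm_add_le _ _) _)
      _ ≤ ‖B₀‖ * ‖e‖ + ‖B₁‖ * ‖e₃‖ + ‖e‖ := by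
          gcongr <;> exact ContinuousLinearMap.norm_compLp_le _ _
      _ = (‖B₀‖ + 1) * ‖e‖ + ‖B₁‖ * ‖e₃‖ := by ring
      _ ≤ K := by rw [hK]; gcongr
  have hgn : ‖g‖ ≤ K + ‖B₀‖ * ‖q‖ + ‖B₁‖ * ‖y‖ + ‖B₂‖ * ‖v‖ := by
    have n1 := norm_sub_le ((B₀.compLp e + B₁.compLp e₃ - e) - B₀.compLp q - B₁.compLp y)
      (B₂.compLp v)
    have n2 := norm_sub_le ((B₀.compLp e + B₁.compLp e₃ - e) - B₀.compLp q) (B₁.compLp y)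
    have n3 := norm_sub_le (B₀.compLp e + B₁.compLp e₃ - e) (B₀.compLp q)
    have n4 := B₀.norm_compLp_le q
    have n5 := B₁.norm_compLp_le y
    have n6 := B₂.norm_compLp_le v
    linarith
  set θ := c₀ ε α β * ‖B₂‖ + c₁ ε α β * ‖B₁‖ + c₂ ε α β * ‖B₀‖ with hθ
  have hG : ‖g‖ ≤ K / (1 - θ) := by
    rw [le_div_iff₀ (by linarith)]
    have n1 := mul_le_mul_of_nonneg_left bv (norm_nonneg B₂)
    have n2 := mul_le_mul_of_nonneg_left byy (norm_nonneg B₁)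
    have n3 := mul_le_mul_of_nonneg_left bq (norm_nonneg B₀)
    rw [hθ]
    linarith
  have hcos : 0 < Real.cos ε := Real.cos_pos_of_mem_Ioo ⟨by linarith [Real.pi_pos], hε⟩
  have hsc : 0 ≤ sectorConst ε := by rw [sectorConst]; split_ifs <;> positivity
  have p0 : 0 ≤ c₀ ε α β := by rw [c₀]; positivity
  have p1 : 0 ≤ c₁ ε α β := by rw [c₁]; positivity
  have p2 : 0 ≤ c₂ ε α β := by rw [c₂]; positivity
  have hbound : ∀ c : ℝ, 0 ≤ c → c ≤ c₀ ε α β + c₁ ε α β + c₂ ε α β → c * ‖g‖ ≤ C := by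
    intro c h0 hle
    calc c * ‖g‖ ≤ (c₀ ε α β + c₁ ε α β + c₂ ε α β) * (K / (1 - θ)) :=
          mul_le_mul hle hG (norm_nonneg _) (by positivity)
      _ ≤ C := by rw [hC]; linarith
  have hfar : ∀ t : ℝ, b < |t| → t ∉ Ioo a b := fun t ht hm =>
    (abs_of_pos (ha.trans hm.1) ▸ ht).not_gt hm.2
  have hX : ∀ᵐ t, (T.compLp v) t = χ t • T (s t) := by
    filter_upwards [T.coeFn_compLp v, m0.coeFn_toLp] with t k1 k2
    rw [k1, k2, T.map_smul_of_tower]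
  refine ⟨p, T.compLp v,
    ⟨y, q, hy1, byy.trans (hbound _ p1 (by linarith)), bq.trans (hbound _ p2 (by linarith)),
      hFq, ?_⟩,
    ⟨v, y, rfl, bv.trans (hbound _ p0 (by linarith)), byy.trans (hbound _ p1 (by linarith)),
      ?_, ?_⟩,
    mp.coeFn_toLp, ?_⟩
  · filter_upwards [mp.coeFn_toLp] with t k1 ht
    rw [k1, hoff hJ t (hfar t ht), hoff hJ' t (hfar t ht)]; simp
  · filter_upwards [hy2, T.coeFn_compLp (𝓕 v)] with ξ k1 k2
    rw [k1, fourier_compLp, k2]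
  · filter_upwards [hX] with t k1 ht
    rw [k1, hoff hJ t (hfar t ht), zero_smul]
  · filter_upwards [ae_restrict_of_ae hX, hx] with t k1 k2
    rw [k1, k2]

end

/-! ### Compactness in the Sobolev space -/

section

variable {H : Type*} [NormedAddCommGroup H] [InnerProductSpace ℂ H]

lemma MemW1.mono {A : H →ₗ.[ℂ] H} {I J : Set ℝ} {u : ℝ → H} (h : MemW1 A I u) (hJ : J ⊆ I) :
    MemW1 A J u := by
  obtain ⟨⟨u', h1, h2⟩, h3, h4⟩ := h
  exact ⟨⟨u', h1.mono hJ, h2.mono_measure (Measure.restrict_mono hJ le_rfl)⟩,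
    ae_restrict_of_ae_restrict_of_subset hJ h3, h4.mono_measure (Measure.restrict_mono hJ le_rfl)⟩

variable [CompleteSpace H]

lemma tendsto_integral_smul {φ : ℝ → ℝ} (hφ : MemLp φ 2)
    {f : ℕ → Lp H 2 (volume : Measure ℝ)} {g : Lp H 2 (volume : Measure ℝ)}
    (h : Tendsto f atTop (𝓝 g)) :
    Tendsto (fun n => ∫ t, φ t • f n t) atTop (𝓝 (∫ t, φ t • g t)) := by
  set L := (ContinuousLinearMap.lsmul ℝ ℝ (E := H)).lpPairing volume 2 2 (hφ.toLp φ) with hL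
  have e : ∀ f : Lp H 2 (volume : Measure ℝ), L f = ∫ t, φ t • f t := by
    intro f
    rw [hL, ContinuousLinearMap.lpPairing_eq_integral]
    refine integral_congr_ae ?_
    filter_upwards [hφ.coeFn_toLp] with t ht
    rw [ContinuousLinearMap.lsmul_apply, ht]
  simpa only [Function.comp_def, e] using (L.continuous.tendsto g).comp h

lemma exists_subseq_tendsto {E : Type*} [NormedAddCommGroup E] [CompleteSpace E] {S : Set E}
    (hS : TotallyBounded S) {f : ℕ → E} (hf : ∀ n, f n ∈ S) :
    ∃ (g : E) (s : ℕ → ℕ), StrictMono s ∧ Tendsto (f ∘ s) atTop (𝓝 g) := by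
  have hc : IsCompact (closure S) := hS.closure.isCompact_of_isClosed isClosed_closure
  obtain ⟨g, -, s, hs, h⟩ := hc.tendsto_subseq fun n => subset_closure (hf n)
  exact ⟨g, s, hs, h⟩

/-- `L²` limits of `u'` and `A u` are `v'` and `A v` for `v = A⁻¹ lim A u`. -/
lemma hasWeakDeriv_of_tendsto (T : H →L[ℂ] H) {J : Set ℝ}
    {u u' : ℕ → ℝ → H} {P X : ℕ → Lp H 2 (volume : Measure ℝ)}
    {P₀ X₀ : Lp H 2 (volume : Measure ℝ)} (hP : Tendsto P atTop (𝓝 P₀))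
    (hX : Tendsto X atTop (𝓝 X₀)) (hu : ∀ n, HasWeakDeriv J (u n) (u' n))
    (hPu : ∀ n, ∀ᵐ t ∂(volume.restrict J), P n t = u' n t)
    (hXu : ∀ n, ∀ᵐ t ∂(volume.restrict J), T (X n t) = u n t) :
    HasWeakDeriv J (fun t => T (X₀ t)) P₀ := by
  have hTX : T.compLp X₀ =ᵐ[volume] fun t => T (X₀ t) := T.coeFn_compLp X₀
  have hTm : MemLp (fun t => T (X₀ t)) 2 := (Lp.memLp (T.compLp X₀)).ae_eq hTX
  refine ⟨(hTm.locallyIntegrable (by norm_num)).locallyIntegrableOn J,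
    ((Lp.memLp P₀).locallyIntegrable (by norm_num)).locallyIntegrableOn J,
    fun ψ h1 h2 h3 => ?_⟩
  have h3' : tsupport (deriv ψ) ⊆ J := tsupport_deriv_subset.trans h3
  rw [setIntegral_smul_eq_integral h3', setIntegral_smul_eq_integral h3]
  have m1 : MemLp (deriv ψ) 2 :=
    (h1.continuous_deriv (by simp)).memLp_of_hasCompactSupport h2.deriv
  have m2 : MemLp ψ 2 := h1.continuous.memLp_of_hasCompactSupport h2
  have hTc : Tendsto (fun n => T.compLp (X n)) atTop (𝓝 (T.compLp X₀)) :=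
    ((T.compLpL 2 volume).continuous.tendsto X₀).comp hX
  have t1 := tendsto_integral_smul m1 hTc
  have t2 := (tendsto_integral_smul m2 hP).neg
  have e1 : ∫ t, deriv ψ t • (T.compLp X₀) t = ∫ t, deriv ψ t • T (X₀ t) :=
    integral_congr_ae (hTX.mono fun t ht => congrArg (deriv ψ t • ·) ht)
  rw [e1] at t1
  refine tendsto_nhds_unique t1 (t2.congr fun n => ?_)
  have e2 : ∫ t, deriv ψ t • (T.compLp (X n)) t = ∫ t, deriv ψ t • u n t := by
    rw [← setIntegral_smul_eq_integral h3', ← setIntegral_smul_eq_integral h3']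
    refine integral_congr_ae ?_
    filter_upwards [hXu n, ae_restrict_of_ae (T.coeFn_compLp (X n))] with t k1 k2
    rw [k2, k1]
  have e3 : ∫ t, ψ t • P n t = ∫ t, ψ t • u' n t := by
    rw [← setIntegral_smul_eq_integral h3, ← setIntegral_smul_eq_integral h3]
    refine integral_congr_ae ?_
    filter_upwards [hPu n] with t k1
    rw [k1]
  rw [e2, e3, (hu n).integral_deriv_smul h1 h2 h3]

/-- A criterion for relative compactness in `W_2^1((a, b); H)`: both `u'` and `A u` are restrictions
of elements of a totally bounded subset of `L²(ℝ; H)`. -/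
lemma relCompactW1_of_totallyBounded {A : H →ₗ.[ℂ] H} {T : H →L[ℂ] H} (hinv : IsBoundedInverse A T)
    {a b : ℝ} {K : Set (ℝ → H)} {S : Set (Lp H 2 (volume : Measure ℝ))} (hS : TotallyBounded S)
    (hK : ∀ u ∈ K, MemW1 A (Ioo a b) u) (h : ∀ u ∈ K, ∃ u' : ℝ → H, ∃ P ∈ S, ∃ X ∈ S,
      HasWeakDeriv (Ioo a b) u u' ∧ (∀ᵐ t ∂(volume.restrict (Ioo a b)), P t = u' t) ∧
      ∀ᵐ t ∂(volume.restrict (Ioo a b)), X t = app A (u t)) :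
    RelCompactW1 A (Ioo a b) K := by
  refine ⟨hK, fun u hu => ?_⟩
  choose! u' P hPS X hXS hd hP hX using fun n => h (u n) (hu n)
  obtain ⟨P₀, s, hs, hP₀⟩ := exists_subseq_tendsto hS hPS
  obtain ⟨X₀, r, hr, hX₀⟩ := exists_subseq_tendsto hS fun n => hXS (s n)
  have hP₀' := hP₀.comp hr.tendsto_atTop
  have hTX : ∀ n, ∀ᵐ t ∂(volume.restrict (Ioo a b)), T (X n t) = u n t := by
    intro n
    filter_upwards [hX n, (hK _ (hu n)).mem_domain] with t k1 k2
    rw [k1, hinv.apply_app k2]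
  have hv : HasWeakDeriv (Ioo a b) (fun t => T (X₀ t)) P₀ :=
    hasWeakDeriv_of_tendsto T hP₀' hX₀ (fun n => hd (s (r n))) (fun n => hP (s (r n)))
      fun n => hTX (s (r n))
  refine ⟨fun t => T (X₀ t), ⟨⟨P₀, hv, (Lp.memLp P₀).restrict _⟩,
    Eventually.of_forall fun t => hinv.mem_domain _, ?_⟩, s ∘ r, hs.comp hr, ?_⟩
  · simp only [hinv.app_apply]
    exact (Lp.memLp X₀).restrict _
  have hlim : Tendsto (fun n => Real.sqrt (‖P (s (r n)) - P₀‖ ^ 2 + ‖X (s (r n)) - X₀‖ ^ 2)) atTop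
      (𝓝 0) := by
    have t1 := (tendsto_iff_norm_sub_tendsto_zero.1 hP₀').pow 2
    have t2 := (tendsto_iff_norm_sub_tendsto_zero.1 hX₀).pow 2
    have := (t1.add t2).sqrt
    simpa using this
  refine squeeze_zero (fun n => Real.sqrt_nonneg _) (fun n => Real.sqrt_le_sqrt ?_) hlim
  have hle : ∀ f : Lp H 2 (volume : Measure ℝ), ∫ t in Ioo a b, ‖f t‖ ^ 2 ≤ ‖f‖ ^ 2 := by
    intro f
    rw [norm_sq_eq_integral]
    exact setIntegral_le_integral ((Lp.memLp f).integrable_norm_pow (by norm_num))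
      (Eventually.of_forall fun t => sq_nonneg _)
  refine add_le_add ((le_of_eq ?_).trans (hle _)) ((le_of_eq ?_).trans (hle _))
  · refine integral_congr_ae ?_
    filter_upwards [((hd (s (r n))).sub hv).weakDeriv_ae_eq isOpen_Ioo, hP (s (r n)),
      ae_restrict_of_ae (Lp.coeFn_sub (P (s (r n))) P₀)] with t k1 k2 k3
    change ‖weakDeriv (Ioo a b) (u (s (r n)) - fun t => T (X₀ t)) t‖ ^ 2 = _
    rw [k1, k3, Pi.sub_apply, Pi.sub_apply, k2]
  · refine integral_congr_ae ?_
    filter_upwards [hTX (s (r n)),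
      ae_restrict_of_ae (Lp.coeFn_sub (X (s (r n))) X₀)] with t k1 k3
    simp only [Function.comp_apply, Pi.sub_apply]
    rw [← k1, ← map_sub, hinv.app_apply, k3, Pi.sub_apply]

end

end OperatorBVP


theorem theorem2 {H : Type*} [NormedAddCommGroup H] [InnerProductSpace ℂ H] [CompleteSpace H]
    [TopologicalSpace.SeparableSpace H]
    (ε α β : ℝ) (hε₀ : 0 ≤ ε) (hε : ε < Real.pi / 2) (hα : 0 < α) (hβ : 0 < β)
    (A : H →ₗ.[ℂ] H) (Ainv : H →L[ℂ] H)
    (hnormal : OperatorBVP.IsNormalOp A)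
    (hinv : OperatorBVP.IsBoundedInverse A Ainv)
    (hcompact : IsCompactOperator Ainv)
    (hspec : OperatorBVP.opSpectrum A ⊆ OperatorBVP.sector ε)
    (A₀ A₁ A₂ : H →ₗ.[ℂ] H) (B₀ B₁ B₂ : H →L[ℂ] H)
    (hB₀ : OperatorBVP.IsBoundedCoeff Ainv 0 A₀ B₀)
    (hB₁ : OperatorBVP.IsBoundedCoeff Ainv 1 A₁ B₁)
    (hB₂ : OperatorBVP.IsBoundedCoeff Ainv 2 A₂ B₂)
    (hsmall : OperatorBVP.c₀ ε α β * ‖B₂‖ + OperatorBVP.c₁ ε α β * ‖B₁‖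
      + OperatorBVP.c₂ ε α β * ‖B₀‖ < 1) :
    OperatorBVP.InteriorCompact A
      (OperatorBVP.solutionSpace A Ainv A₀ A₁ A₂ α β) := by
  intro a a₁ b₁ b M ha h₁ h₂ h₃ hM
  have hT : IsStarNormal Ainv := hinv.isStarNormal hnormal
  obtain ⟨U, hU, hU1⟩ := OperatorBVP.exists_contraction_comp_eq_adjoint Ainv
    (hinv.denseRange hnormal.dense)
  obtain ⟨χ, κ, hχ, hc, hJ, hχ1, hκ⟩ := OperatorBVP.exists_cutoff h₁ h₂ h₃
  have hsub : Ioo a₁ b₁ ⊆ Ioo a b := Ioo_subset_Ioo h₁.le h₃.le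
  have hsub0 : Ioo a b ⊆ Ioi 0 := fun t ht => ha.trans ht.1
  have hb : 0 < b := by linarith
  set K := (‖B₀‖ + 1) * (κ * (‖Ainv‖ * M) + 2 * (κ * M)) + ‖B₁‖ * (κ * M) with hK
  set C := (OperatorBVP.c₀ ε α β + OperatorBVP.c₁ ε α β + OperatorBVP.c₂ ε α β)
    * (K / (1 - (OperatorBVP.c₀ ε α β * ‖B₂‖ + OperatorBVP.c₁ ε α β * ‖B₁‖
      + OperatorBVP.c₂ ε α β * ‖B₀‖))) + 1 with hC
  have hC0 : 0 < C := by
    have hcos : 0 < Real.cos ε := Real.cos_pos_of_mem_Ioo ⟨by linarith [Real.pi_pos], hε⟩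
    have hκ0 : 0 ≤ κ := (norm_nonneg _).trans (hκ 0).1
    have hsc : 0 ≤ OperatorBVP.sectorConst ε := by
      rw [OperatorBVP.sectorConst]; split_ifs <;> positivity
    have p0 : 0 ≤ OperatorBVP.c₀ ε α β := by rw [OperatorBVP.c₀]; positivity
    have p1 : 0 ≤ OperatorBVP.c₁ ε α β := by rw [OperatorBVP.c₁]; positivity
    have p2 : 0 ≤ OperatorBVP.c₂ ε α β := by rw [OperatorBVP.c₂]; positivity
    have p3 : 0 ≤ K := by positivity
    have p4 := div_nonneg p3 (sub_nonneg.2 hsmall.le)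
    positivity
  refine OperatorBVP.relCompactW1_of_totallyBounded hinv
    (OperatorBVP.totallyBounded_boundedPrimitives hcompact hb hC0) (fun u hu => hu.2.1.mono hsub) ?_
  rintro u ⟨⟨⟨⟨w₁, w₂, hw₁, hw₂, mw₂⟩, hdom, hop⟩, hsol, -⟩, ⟨⟨⟨z, hz, mz⟩, -, mx⟩, hnorm⟩⟩
  set u₁ := OperatorBVP.weakDeriv (Ioi 0) u with hu₁
  set u₂ := OperatorBVP.weakDeriv (Ioi 0) u₁ with hu₂
  have d₁ : OperatorBVP.HasWeakDeriv (Ioi 0) u u₁ := hw₁.hasWeakDeriv_weakDeriv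
  have d₂' : OperatorBVP.HasWeakDeriv (Ioi 0) u₁ w₂ :=
    hw₂.congr_ae (hw₁.ae_eq isOpen_Ioi d₁) (EventuallyEq.refl _ _)
  have d₂ : OperatorBVP.HasWeakDeriv (Ioi 0) u₁ u₂ := d₂'.hasWeakDeriv_weakDeriv
  have mu₂ : MemLp u₂ 2 (volume.restrict (Ioo a b)) :=
    (mw₂.ae_eq (d₂'.ae_eq isOpen_Ioi d₂)).mono_measure (Measure.restrict_mono hsub0 le_rfl)
  have mu₁ : MemLp u₁ 2 (volume.restrict (Ioo a b)) :=
    mz.ae_eq (hz.ae_eq isOpen_Ioo (d₁.mono hsub0))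
  have ms := hop.mono_measure (Measure.restrict_mono hsub0 le_rfl)
  have hdom' := ae_restrict_of_ae_restrict_of_subset hsub0 hdom
  have hS := (Real.sqrt_le_left hM.le).1 hnorm
  have hint : ∫ t in Ioo a b, ‖OperatorBVP.weakDeriv (Ioo a b) u t‖ ^ 2
      = ∫ t in Ioo a b, ‖u₁ t‖ ^ 2 := by
    refine integral_congr_ae ?_
    filter_upwards [(d₁.mono hsub0).weakDeriv_ae_eq isOpen_Ioo] with t ht
    rw [ht]
  rw [hint] at hS
  have n1 : 0 ≤ ∫ t in Ioo a b, ‖u₁ t‖ ^ 2 := integral_nonneg fun t => sq_nonneg _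
  have n2 : 0 ≤ ∫ t in Ioo a b, ‖OperatorBVP.app A (u t)‖ ^ 2 :=
    integral_nonneg fun t => sq_nonneg _
  obtain ⟨P, X, hP, hX, hPu, hXu⟩ := OperatorBVP.mem_boundedPrimitives_of_solution Ainv U
    hinv.injective hε₀ hε hα hβ (hinv.spectrum_subset hε₀ hε hspec) hU hU1 B₀ B₁ B₂ hsmall ha hχ
    hc hJ hκ hM.le (d₁.mono hsub0) (d₂.mono hsub0) mu₁ mu₂ ms mx (by linarith) (by linarith)
    (hdom'.mono fun t ht => (hinv.apply_app ht.1).symm)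
    (hdom'.mono fun t ht => (hinv.apply_app ht.2).symm)
    (by
      filter_upwards [ae_restrict_of_ae_restrict_of_subset hsub0 hsol] with t ht y hy
      obtain ⟨hD, -, -, -, he⟩ := ht
      have e0 : OperatorBVP.app A₀ (u₂ t) = B₀ (u₂ t) := hB₀.app_apply (u₂ t)
      have e1 : OperatorBVP.app A₁ (u₁ t) = B₁ y := by
        rw [hy]; simpa using hB₁.app_apply y
      have e2 : OperatorBVP.app A₂ (u t) = B₂ (OperatorBVP.app A (OperatorBVP.app A (u t))) := by
        have := hB₂.app_apply (OperatorBVP.app A (OperatorBVP.app A (u t)))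
        rwa [pow_two, mul_apply_eq_comp, hinv.apply_app hD.2, hinv.apply_app hD.1] at this
      rw [← e0, ← e1, ← e2]
      exact he) hK hC
  refine ⟨u₁, P, hP, X, hX, (d₁.mono hsub0).mono hsub, ?_, ?_⟩
  · filter_upwards [ae_restrict_of_ae hPu, ae_restrict_mem measurableSet_Ioo] with t k1 k2
    rw [k1, (hχ1 t k2).1, (hχ1 t k2).2, zero_smul, one_smul, zero_add]
  · filter_upwards [ae_restrict_of_ae_restrict_of_subset hsub hXu,
      ae_restrict_mem measurableSet_Ioo] with t k1 k2
    rw [k1, (hχ1 t k2).1, one_smul]
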